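/- Let $N\in\mathbb N$ and let $m,p,\sigma$ be real numbers with $$1<m<p<N,\qquad p-1\le m<p-1+\frac pN,\qquad p<\sigma<p^*:=\frac{Np}{N-p}.$$ Let $\Omega\subset\mathbb R^N$ be an open set with bounded complement, and let $V:\Omega\to\mathbb R$ be continuous with $V(x)\to V_\infty\in\mathbb R$ as $|x|\to\infty$, $x\in\Omega$, and $\inf_\Omega V>0$. Let $L:\mathbb R^N\to\mathbb R$, $M:\mathbb R\times\mathbb R^N\to\mathbb R$ and $G:\mathbb R\to\mathbb R$ be of class $C^1$, let $L$ and, for each $s\in\mathbb R$, the map $\xi\mapsto M(s,\xi)$ be strictly convex, and suppose that there are constants $\nu>0$ and $C$ such that for all $(s,\xi)\in\mathbb R\times\mathbb R^N$ $$\nu|\xi|^p\le|L(\xi)|\le C|\xi|^p,\quad |L_\xi(\xi)|\le C|\xi|^{p-1},\quad \nu|\xi|^m\le M(s,\xi)\le C|\xi|^m,$$ $$|M_s(s,\xi)|\le C|\xi|^m,\quad |M_\xi(s,\xi)|\le C|\xi|^{m-1},\quad |G'(s)|\le C|s|^{\sigma-1},$$ and that the sign condition $M_s(s,\xi)\,s\ge0$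 holds for all $(s,\xi)\in\mathbb R\times\mathbb R^N$. Put $g=G'$. Let $X=W^{1,p}_0(\Omega)\cap D^{1,m}_0(\Omega)$ be the completion of the space of smooth functions with compact support in $\Omega$ for the norm $\|u\|_{W^{1,p}(\Omega)}+\|Du\|_{L^m(\Omega)}$; that is, the set of $u\in W^{1,p}(\Omega)$ with $Du\in L^m(\Omega)$ that are limits of such functions in this norm. Let $u\in X$ be a weak solution of $$-\operatorname{div}(L_\xi(Du))-\operatorname{div}(M_\xi(u,Du))+M_s(u,Du)+V(x)|u|^{p-2}u=g(u)\quad\text{in }\Omega,$$ that is, for every $v\in X$ the function $V|u|^{p-2}uv$ is integrable on $\Omega$ (which is automatic if $V$ is bounded) and $$\int_\Omega L_\xi(Du)\cdot Dv+\int_\Omega M_\xi(u,Du)\cdot Dv+\int_\Omega M_s(u,Du)\,v+\int_\Omega V|u|^{p-2}u\,v=\int_\Omega g(u)\,v .$$ Then $u\in L^q(\Omega)$ for every real $q\ge p$, $u\in L^\infty(\Omega)$, and $u(x)\to0$ as $|x|\to\infty$, in the sense that for every $\varepsilon>0$ there is $R$ such that $|u(x)|\le\varepsilon$ for almost every $x\in\Omega$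 with $|x|\ge R$. -/

import Mathlib

open MeasureTheory Filter Topology
open scoped ENNReal Gradient ContDiff

/-- `ℝ^N` with its Euclidean norm. -/
abbrev Eucl (N : ℕ) : Type := EuclideanSpace ℝ (Fin N)

/-- `φ` belongs to `𝓓(Ω)`, the smooth functions with compact support contained in `Ω`. -/
structure IsTestFunction {N : ℕ} (Ω : Set (Eucl N)) (φ : Eucl N → ℝ) : Prop where
  smooth : ContDiff ℝ ∞ φ
  compact : HasCompactSupport φ
  support_subset : tsupport φ ⊆ Ω

/-- `w` is the weak (distributional) gradient of `u` in `Ω`. -/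
def IsWeakGradient {N : ℕ} (Ω : Set (Eucl N)) (u : Eucl N → ℝ) (w : Eucl N → Eucl N) : Prop :=
  LocallyIntegrableOn u Ω volume ∧ LocallyIntegrableOn w Ω volume ∧
    ∀ φ : Eucl N → ℝ, IsTestFunction Ω φ →
      ∫ x in Ω, u x • ∇ φ x = - ∫ x in Ω, φ x • w x

/-- `u` belongs to `W₀^{1,p}(Ω) ∩ D₀^{1,m}(Ω)`, and `w = Du` is its weak gradient. The space is the
completion of `𝓓(Ω)` for the norm `‖u‖_{W^{1,p}(Ω)} + ‖Du‖_{L^m(Ω)}`, that is, the set of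
`u ∈ W^{1,p}(Ω)` with `Du ∈ L^m(Ω)` which are limits of test functions in this norm. -/
structure MemSobolevZero {N : ℕ} (Ω : Set (Eucl N)) (p m : ℝ)
    (u : Eucl N → ℝ) (w : Eucl N → Eucl N) : Prop where
  memLp : MemLp u (ENNReal.ofReal p) (volume.restrict Ω)
  grad_memLp : MemLp w (ENNReal.ofReal p) (volume.restrict Ω)
  grad_memLm : MemLp w (ENNReal.ofReal m) (volume.restrict Ω)
  weakGradient : IsWeakGradient Ω u w
  approx : ∃ φ : ℕ → Eucl N → ℝ, (∀ n, IsTestFunction Ω (φ n)) ∧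
    Tendsto (fun n => eLpNorm (fun x => φ n x - u x) (ENNReal.ofReal p) (volume.restrict Ω))
      atTop (𝓝 0) ∧
    Tendsto (fun n => eLpNorm (fun x => ∇ (φ n) x - w x) (ENNReal.ofReal p) (volume.restrict Ω))
      atTop (𝓝 0) ∧
    Tendsto (fun n => eLpNorm (fun x => ∇ (φ n) x - w x) (ENNReal.ofReal m) (volume.restrict Ω))
      atTop (𝓝 0)

/-- `u ∈ W₀^{1,p}(Ω) ∩ D₀^{1,m}(Ω)` is a weak solution of
`-div(L_ξ(Du)) - div(M_ξ(u,Du)) + M_s(u,Du) + V(x)|u|^{p-2}u = G'(u)` in `Ω`, tested against the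
whole space `W₀^{1,p}(Ω) ∩ D₀^{1,m}(Ω)`. The integrability of the potential term is automatic when
`V` is bounded on `Ω`; the other four integrands are integrable by the growth conditions under
which the definition is used. -/
def IsWeakSolution {N : ℕ} (Ω : Set (Eucl N)) (p m : ℝ) (L : Eucl N → ℝ) (M : ℝ → Eucl N → ℝ)
    (G : ℝ → ℝ) (V : Eucl N → ℝ) (u : Eucl N → ℝ) : Prop :=
  ∃ Du : Eucl N → Eucl N, MemSobolevZero Ω p m u Du ∧
    ∀ (v : Eucl N → ℝ) (Dv : Eucl N → Eucl N), MemSobolevZero Ω p m v Dv →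
      IntegrableOn (fun x => V x * (|u x| ^ (p - 2) * u x) * v x) Ω volume ∧
      (∫ x in Ω, inner ℝ (∇ L (Du x)) (Dv x))
        + (∫ x in Ω, inner ℝ (∇ (fun ξ => M (u x) ξ) (Du x)) (Dv x))
        + (∫ x in Ω, deriv (fun s => M s (Du x)) (u x) * v x)
        + (∫ x in Ω, V x * (|u x| ^ (p - 2) * u x) * v x)
      = ∫ x in Ω, deriv G (u x) * v x

/-! The proof is a De Giorgi iteration at the Sobolev exponent `q = Np/(N - p)`. The test functions
are `v = ηⁿ F(u)`, where `F` is a smooth odd truncation vanishing for `|s| ≤ k` and `η` is a cutoff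
that may equal `1` near infinity. Since `v` has the sign of `u`, the terms in `M_s` and `V` are
nonnegative and can be dropped. Convexity makes both fluxes coercive, and `|F(s)| ≤ |s| F'(s)` lets
Young's inequality absorb the terms in `Dη`.

What remains is of order `|u|^p`, `|u|^m` and `|u|^σ` and lives on `{η ≠ 0, |u| > k}`. There each
power is at most a negative or zero power of `k` times `|u|^q`, because `m < p < σ ≤ q`. Hence `∫
|Dv|^p` is controlled by the energy `∫ |u|^q` over that set
(`IsEnergySolution.exists_integral_norm_rpow_le`), and the Sobolev inequality raises this energy to
the power `q/p > 1` (`exists_levelEnergy_le`). Along levels rising from `k` to `2k`, with nested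
cutoffs, the energy then tends to zero as soon as its first value is small (`exists_ae_abs_le`).

Smallness comes from `u ∈ L^q`, in two ways. With `η = 1` and `k` large it gives boundedness
(`memLp_top`); with `k = ε/2` and `η` supported far out it gives decay at infinity
(`exists_ae_abs_le_of_le_norm`). The finite exponents follow by interpolation between `L^p` and
`L^∞`. -/

/-! ### Convergence in Lebesgue spaces. -/

section LpConvergence

variable {α E : Type*} {_ : MeasurableSpace α} {μ : Measure α} [NormedAddCommGroup E]

theorem tendsto_eLpNorm_zero_of_dominated {r : ℝ≥0∞} (hr0 : r ≠ 0) (hrt : r ≠ ⊤)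
    {f : ℕ → α → E} {g : α → ℝ} (hf : ∀ n, AEStronglyMeasurable (f n) μ) (hg : MemLp g r μ)
    (hfg : ∀ n, ∀ᵐ x ∂μ, ‖f n x‖ ≤ ‖g x‖)
    (hlim : ∀ᵐ x ∂μ, Tendsto (fun n => f n x) atTop (𝓝 0)) :
    Tendsto (fun n => eLpNorm (f n) r μ) atTop (𝓝 0) := by
  have hr : 0 < r.toReal := ENNReal.toReal_pos hr0 hrt
  simp_rw [eLpNorm_eq_lintegral_rpow_enorm_toReal hr0 hrt]
  have hI : Tendsto (fun n => ∫⁻ x, ‖f n x‖ₑ ^ r.toReal ∂μ) atTop (𝓝 (∫⁻ _, 0 ∂μ)) := by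
    refine tendsto_lintegral_of_dominated_convergence' (fun x => ‖g x‖ₑ ^ r.toReal)
      (fun n => (hf n).enorm.pow_const _) (fun n => ?_) ?_ ?_
    · filter_upwards [hfg n] with x hx
      gcongr
      exact enorm_le_iff_norm_le.2 hx
    · exact (lintegral_rpow_enorm_lt_top_of_eLpNorm_lt_top hr0 hrt hg.2).ne
    · filter_upwards [hlim] with x hx
      have := (ENNReal.continuous_rpow_const (y := r.toReal)).tendsto 0 |>.comp
        (by simpa using hx.enorm : Tendsto (fun n => ‖f n x‖ₑ) atTop (𝓝 0))
      simpa [Function.comp_def, hr] using this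
  have := (ENNReal.continuous_rpow_const (y := 1 / r.toReal)).tendsto _ |>.comp hI
  simpa [Function.comp_def, hr] using this

/-- Split into `θₙ (gₙ - w) + (θₙ - θ') w`: the first term is small by the uniform bound, the second
by dominated convergence. It serves the chain rule, with `θₙ = F'(φₙ)`. -/
theorem tendsto_eLpNorm_smul_sub_smul [NormedSpace ℝ E] {r : ℝ≥0∞} (hr1 : 1 ≤ r) (hrt : r ≠ ⊤)
    {K : ℝ} {θ : ℕ → α → ℝ} {θ' : α → ℝ} {g : ℕ → α → E} {w : α → E}
    (hθ : ∀ n, AEStronglyMeasurable (θ n) μ) (hθ' : AEStronglyMeasurable θ' μ)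
    (hK : ∀ n x, |θ n x| ≤ K) (hK' : ∀ x, |θ' x| ≤ K)
    (hlim : ∀ᵐ x ∂μ, Tendsto (fun n => θ n x) atTop (𝓝 (θ' x)))
    (hg : ∀ n, AEStronglyMeasurable (g n) μ) (hw : MemLp w r μ)
    (hgw : Tendsto (fun n => eLpNorm (fun x => g n x - w x) r μ) atTop (𝓝 0)) :
    Tendsto (fun n => eLpNorm (fun x => θ n x • g n x - θ' x • w x) r μ) atTop (𝓝 0) := by
  have h1 : Tendsto (fun n => ENNReal.ofReal K * eLpNorm (fun x => g n x - w x) r μ)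
      atTop (𝓝 0) := by
    simpa using ENNReal.Tendsto.const_mul hgw (Or.inr ENNReal.ofReal_ne_top)
  have h2 : Tendsto (fun n => eLpNorm (fun x => (θ n x - θ' x) • w x) r μ) atTop (𝓝 0) := by
    refine tendsto_eLpNorm_zero_of_dominated (by positivity) hrt
      (g := fun x => (2 * K) * ‖w x‖) (fun n => ((hθ n).sub hθ').smul hw.1)
      (hw.norm.const_mul _) (fun n => .of_forall fun x => ?_) ?_
    · rw [norm_smul, norm_mul, norm_norm]
      gcongr
      calc ‖θ n x - θ' x‖ ≤ |θ n x| + |θ' x| := norm_sub_le _ _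
        _ ≤ 2 * K := by linarith [hK n x, hK' x]
        _ ≤ ‖2 * K‖ := Real.le_norm_self _
    · filter_upwards [hlim] with x hx
      have : Tendsto (fun n => θ n x - θ' x) atTop (𝓝 0) := by
        simpa using hx.sub_const (θ' x)
      simpa using this.smul_const (w x)
  refine tendsto_of_tendsto_of_tendsto_of_le_of_le tendsto_const_nhds
    (by simpa using h1.add h2) (fun _ => zero_le) (fun n => ?_)
  have hsplit : (fun x => θ n x • g n x - θ' x • w x)
      = (fun x => θ n x • (g n x - w x)) + fun x => (θ n x - θ' x) • w x := by
    ext x; simp only [Pi.add_apply, smul_sub, sub_smul]; abel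
  rw [hsplit]
  refine (eLpNorm_add_le ((hθ n).smul ((hg n).sub hw.1)) (((hθ n).sub hθ').smul hw.1) hr1).trans ?_
  refine add_le_add (eLpNorm_le_mul_eLpNorm_of_ae_le_mul (.of_forall fun x => ?_) _) le_rfl
  exact (norm_smul _ _).trans_le (mul_le_mul_of_nonneg_right (hK n x) (norm_nonneg _))

theorem tendsto_integral_smul_of_tendsto_eLpNorm [NormedSpace ℝ E] {r s : ℝ≥0∞}
    [r.HolderTriple s 1]
    {f : ℕ → α → ℝ} {f' : α → ℝ} {g : α → E} (hf : ∀ n, MemLp (f n) r μ) (hf' : MemLp f' r μ)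
    (hg : MemLp g s μ)
    (h : Tendsto (fun n => eLpNorm (fun x => f n x - f' x) r μ) atTop (𝓝 0)) :
    Tendsto (fun n => ∫ x, f n x • g x ∂μ) atTop (𝓝 (∫ x, f' x • g x ∂μ)) := by
  have hsm : ∀ {φ : α → ℝ}, MemLp φ r μ → MemLp (φ • g) 1 μ := fun hφ => hg.smul hφ
  refine tendsto_integral_of_L1 _ (hsm hf').1
    (.of_forall fun n => memLp_one_iff_integrable.1 (hsm (hf n))) ?_
  have h0 : Tendsto (fun n => eLpNorm (fun x => f n x - f' x) r μ * eLpNorm g s μ)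
      atTop (𝓝 0) := by
    simpa using ENNReal.Tendsto.mul_const h (Or.inr hg.2.ne)
  refine tendsto_of_tendsto_of_tendsto_of_le_of_le tendsto_const_nhds h0 (fun _ => zero_le)
    (fun n => ?_)
  have := eLpNorm_smul_le_mul_eLpNorm (p := r) (q := s) (r := 1) hg.1 ((hf n).sub hf').1
  rw [eLpNorm_one_eq_lintegral_enorm] at this
  simpa [sub_smul, Pi.sub_def] using this

end LpConvergence

/-! ### Calculus of gradients. -/

section Gradient

variable {E : Type*} [NormedAddCommGroup E] [InnerProductSpace ℝ E] [CompleteSpace E]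

theorem ContDiff.continuous_gradient {f : E → ℝ} (hf : ContDiff ℝ 1 f) : Continuous (∇ f) :=
  (InnerProductSpace.toDual ℝ E).symm.continuous.comp (hf.continuous_fderiv one_ne_zero)

theorem norm_gradient (f : E → ℝ) (x : E) : ‖∇ f x‖ = ‖fderiv ℝ f x‖ :=
  (InnerProductSpace.toDual ℝ E).symm.norm_map _

theorem gradient_comp {F : ℝ → ℝ} {f : E → ℝ} {x : E} (hF : DifferentiableAt ℝ F (f x))
    (hf : DifferentiableAt ℝ f x) : ∇ (fun y => F (f y)) x = deriv F (f x) • ∇ f x := by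
  refine HasGradientAt.gradient (hasGradientAt_iff_hasFDerivAt.2 ?_)
  rw [map_smulₛₗ, toDual_gradient]
  exact hF.hasDerivAt.comp_hasFDerivAt x hf.hasFDerivAt

theorem gradient_mul {f g : E → ℝ} {x : E} (hf : DifferentiableAt ℝ f x)
    (hg : DifferentiableAt ℝ g x) :
    ∇ (fun y => f y * g y) x = f x • ∇ g x + g x • ∇ f x := by
  refine HasGradientAt.gradient (hasGradientAt_iff_hasFDerivAt.2 ?_)
  rw [map_add, map_smulₛₗ, map_smulₛₗ, toDual_gradient, toDual_gradient]
  exact hf.hasFDerivAt.mul hg.hasFDerivAt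

theorem HasCompactSupport.gradient {f : E → ℝ} (hf : HasCompactSupport f) :
    HasCompactSupport (∇ f) :=
  (hf.fderiv ℝ).comp_left (map_zero (InnerProductSpace.toDual ℝ E).symm)

theorem tsupport_gradient_subset (f : E → ℝ) : tsupport (∇ f) ⊆ tsupport f := by
  refine closure_minimal (fun x hx => ?_) (isClosed_tsupport f)
  refine support_fderiv_subset ℝ fun h => hx ?_
  simp [_root_.gradient, h]

end Gradient

/-! ### Test functions and the space `W₀^{1,p} ∩ D₀^{1,m}`. -/

variable {N : ℕ} {Ω : Set (Eucl N)}

namespace IsTestFunction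

variable {φ ψ : Eucl N → ℝ}

theorem contDiff_one (hφ : IsTestFunction Ω φ) : ContDiff ℝ 1 φ := hφ.smooth.of_le (by simp)

theorem differentiable (hφ : IsTestFunction Ω φ) : Differentiable ℝ φ :=
  hφ.contDiff_one.differentiable one_ne_zero

theorem memLp (hφ : IsTestFunction Ω φ) (r : ℝ≥0∞) : MemLp φ r (volume.restrict Ω) :=
  (hφ.smooth.continuous.memLp_of_hasCompactSupport hφ.compact).restrict _

theorem gradient_memLp (hφ : IsTestFunction Ω φ) (r : ℝ≥0∞) :
    MemLp (∇ φ) r (volume.restrict Ω) :=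
  (hφ.contDiff_one.continuous_gradient.memLp_of_hasCompactSupport hφ.compact.gradient).restrict _

theorem integral_smul_gradient (hφ : IsTestFunction Ω φ) (hψ : IsTestFunction Ω ψ) :
    ∫ x in Ω, φ x • ∇ ψ x = - ∫ x in Ω, ψ x • ∇ φ x := by
  have aux : ∀ {f g : Eucl N → ℝ}, IsTestFunction Ω f → IsTestFunction Ω g →
      Integrable (fun x => f x • ∇ g x) := fun {f g} hf hg =>
    (hf.smooth.continuous.smul hg.contDiff_one.continuous_gradient).integrable_of_hasCompactSupport
      hf.compact.smul_right
  -- Supports lie in `Ω`, so the integrals may be taken over the whole space and no boundary term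
  -- appears.
  have hzero : ∀ {f : Eucl N → ℝ} (g : Eucl N → Eucl N), IsTestFunction Ω f →
      ∫ x in Ω, f x • g x = ∫ x, f x • g x := fun {f} g hf =>
    setIntegral_eq_integral_of_forall_compl_eq_zero fun x hx => by
      rw [image_eq_zero_of_notMem_tsupport fun h => hx (hf.support_subset h), zero_smul]
  rw [hzero _ hφ, hzero _ hψ]
  refine ext_inner_left ℝ fun v => ?_
  rw [inner_neg_right, ← integral_inner (aux hφ hψ), ← integral_inner (aux hψ hφ)]
  have h1 := (aux hφ hψ).const_inner (𝕜 := ℝ) v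
  have h2 := (aux hψ hφ).const_inner (𝕜 := ℝ) v
  simp only [inner_smul_right, inner_gradient_right, starRingEnd_apply, star_trivial] at h1 h2 ⊢
  have h := integral_mul_fderiv_eq_neg_fderiv_mul_of_integrable (μ := volume) (f := φ) (g := ψ)
    (v := v) (by simpa only [mul_comm] using h2) h1
    ((hφ.smooth.continuous.mul hψ.smooth.continuous).integrable_of_hasCompactSupport
      hφ.compact.mul_right) (fun x _ => hφ.differentiable x) (fun x _ => hψ.differentiable x)
  simpa only [mul_comm] using h

end IsTestFunction

theorem ENNReal.exists_holderTriple {p r : ℝ≥0∞} (hr : r ≤ p) :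
    ∃ s : ℝ≥0∞, p.HolderTriple s r := by
  obtain ⟨a, ha⟩ := exists_add_of_le (ENNReal.inv_le_inv.2 hr)
  exact ⟨a⁻¹, ⟨by simp [← ha]⟩⟩

namespace MemSobolevZero

variable {p m : ℝ} {u : Eucl N → ℝ} {w : Eucl N → Eucl N}

/-- The weak gradient condition is inherited from the approximating sequence: by Hölder, both sides
of the integration by parts formula for test functions pass to the limit. -/
theorem of_approx (hp : 1 ≤ p)
    (hu : MemLp u (ENNReal.ofReal p) (volume.restrict Ω))
    (hwp : MemLp w (ENNReal.ofReal p) (volume.restrict Ω))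
    (hwm : MemLp w (ENNReal.ofReal m) (volume.restrict Ω))
    (h : ∃ φ : ℕ → Eucl N → ℝ, (∀ n, IsTestFunction Ω (φ n)) ∧
      Tendsto (fun n => eLpNorm (fun x => φ n x - u x) (ENNReal.ofReal p) (volume.restrict Ω))
        atTop (𝓝 0) ∧
      Tendsto (fun n => eLpNorm (fun x => ∇ (φ n) x - w x) (ENNReal.ofReal p)
        (volume.restrict Ω)) atTop (𝓝 0) ∧
      Tendsto (fun n => eLpNorm (fun x => ∇ (φ n) x - w x) (ENNReal.ofReal m)
        (volume.restrict Ω)) atTop (𝓝 0)) :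
    MemSobolevZero Ω p m u w := by
  refine ⟨hu, hwp, hwm, ⟨?_, ?_, fun ψ hψ => ?_⟩, h⟩
  · exact locallyIntegrableOn_of_locallyIntegrable_restrict
      (hu.locallyIntegrable (ENNReal.one_le_ofReal.2 hp))
  · exact locallyIntegrableOn_of_locallyIntegrable_restrict
      (hwp.locallyIntegrable (ENNReal.one_le_ofReal.2 hp))
  obtain ⟨φ, hφ, h1, h2, -⟩ := h
  obtain ⟨s, hs⟩ := ENNReal.exists_holderTriple (ENNReal.one_le_ofReal.2 hp)
  have L1 := tendsto_integral_smul_of_tendsto_eLpNorm (s := s) (fun n => (hφ n).memLp _) hu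
    (hψ.gradient_memLp s) h1
  have L2 : Tendsto (fun n => ∫ x in Ω, ψ x • ∇ (φ n) x) atTop (𝓝 (∫ x in Ω, ψ x • w x)) := by
    have hst : s.HolderTriple (ENNReal.ofReal p) 1 := ENNReal.HolderTriple.symm
    have hsm : ∀ {g : Eucl N → Eucl N}, MemLp g (ENNReal.ofReal p) (volume.restrict Ω) →
        MemLp (ψ • g) 1 (volume.restrict Ω) := fun hg => hg.smul (hψ.memLp s)
    refine tendsto_integral_of_L1 _ (hsm hwp).1
      (.of_forall fun n => memLp_one_iff_integrable.1 (hsm ((hφ n).gradient_memLp _))) ?_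
    have h0 : Tendsto (fun n => eLpNorm ψ s (volume.restrict Ω) *
        eLpNorm (fun x => ∇ (φ n) x - w x) (ENNReal.ofReal p) (volume.restrict Ω))
        atTop (𝓝 0) := by
      simpa using ENNReal.Tendsto.const_mul h2 (Or.inr (hψ.memLp s).2.ne)
    refine tendsto_of_tendsto_of_tendsto_of_le_of_le tendsto_const_nhds h0 (fun _ => zero_le)
      (fun n => ?_)
    have := eLpNorm_smul_le_mul_eLpNorm (p := s) (q := ENNReal.ofReal p) (r := 1) (((hφ n).gradient_memLp _).sub hwp).1
      (hψ.memLp s).1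
    rw [eLpNorm_one_eq_lintegral_enorm] at this
    simpa [smul_sub, Pi.sub_def] using this
  refine tendsto_nhds_unique L1 ?_
  simpa only [(hφ _).integral_smul_gradient hψ] using L2.neg

/-- Approximating test functions which also converge almost everywhere. -/
theorem exists_ae_approx (hp : 1 ≤ p) (h : MemSobolevZero Ω p m u w) :
    ∃ φ : ℕ → Eucl N → ℝ, (∀ n, IsTestFunction Ω (φ n)) ∧
      (∀ᵐ x ∂volume.restrict Ω, Tendsto (fun n => φ n x) atTop (𝓝 (u x))) ∧
      Tendsto (fun n => eLpNorm (fun x => φ n x - u x) (ENNReal.ofReal p) (volume.restrict Ω))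
        atTop (𝓝 0) ∧
      Tendsto (fun n => eLpNorm (fun x => ∇ (φ n) x - w x) (ENNReal.ofReal p)
        (volume.restrict Ω)) atTop (𝓝 0) ∧
      Tendsto (fun n => eLpNorm (fun x => ∇ (φ n) x - w x) (ENNReal.ofReal m)
        (volume.restrict Ω)) atTop (𝓝 0) := by
  obtain ⟨φ, hφ, h1, h2, h3⟩ := h.approx
  obtain ⟨ns, hns, hlim⟩ := (tendstoInMeasure_of_tendsto_eLpNorm (by simp; linarith)
    (fun n => ((hφ n).memLp 1).1) h.memLp.1 h1).exists_seq_tendsto_ae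
  exact ⟨fun n => φ (ns n), fun n => hφ _, hlim, h1.comp hns.tendsto_atTop,
    h2.comp hns.tendsto_atTop, h3.comp hns.tendsto_atTop⟩

/-- Smoothness of `F` and `F 0 = 0` make `F ∘ φₙ` a test function again, so no mollification is
needed. Almost everywhere convergence of `φₙ` handles the factor `F'(φₙ)`. -/
theorem comp (hp : 1 ≤ p) (hm : 1 ≤ m) {F : ℝ → ℝ} {K : ℝ} (hF : ContDiff ℝ ∞ F)
    (hF0 : F 0 = 0) (hK : ∀ s, |deriv F s| ≤ K) (h : MemSobolevZero Ω p m u w) :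
    MemSobolevZero Ω p m (fun x => F (u x)) (fun x => deriv F (u x) • w x) := by
  have hFd : Differentiable ℝ F := hF.differentiable (by simp)
  have hF' : Continuous (deriv F) := hF.continuous_deriv (by simp)
  have hLip : ∀ a b, |F a - F b| ≤ K * |a - b| := fun a b =>
    Convex.norm_image_sub_le_of_norm_deriv_le (fun x _ => hFd x) (fun x _ => hK x) convex_univ
      (Set.mem_univ b) (Set.mem_univ a)
  have hmF : AEStronglyMeasurable (fun x => deriv F (u x)) (volume.restrict Ω) :=
    hF'.comp_aestronglyMeasurable h.memLp.1
  have hmem : ∀ r, MemLp w r (volume.restrict Ω) →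
      MemLp (fun x => deriv F (u x) • w x) r (volume.restrict Ω) := fun r hr =>
    hr.of_le_mul (c := K) (hmF.smul hr.1) (.of_forall fun x => by
      rw [norm_smul]; gcongr; exact hK _)
  obtain ⟨φ, hφ, hae, h1, h2, h3⟩ := h.exists_ae_approx hp
  have hg : ∀ n x, ∇ (fun y => F (φ n y)) x = deriv F (φ n x) • ∇ (φ n) x := fun n x =>
    gradient_comp (hFd _) ((hφ n).differentiable x)
  have hgrad : ∀ r : ℝ≥0∞, 1 ≤ r → r ≠ ⊤ → MemLp w r (volume.restrict Ω) →
      Tendsto (fun n => eLpNorm (fun x => ∇ (φ n) x - w x) r (volume.restrict Ω)) atTop (𝓝 0) →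
      Tendsto (fun n => eLpNorm (fun x => ∇ (fun y => F (φ n y)) x - deriv F (u x) • w x) r
        (volume.restrict Ω)) atTop (𝓝 0) := fun r hr hr' hw hlim => by
    simp only [hg]
    refine tendsto_eLpNorm_smul_sub_smul hr hr'
      (fun n => (hF'.comp (hφ n).smooth.continuous).aestronglyMeasurable) hmF
      (fun n x => hK _) (fun x => hK _) ?_ (fun n => ((hφ n).gradient_memLp r).1) hw hlim
    filter_upwards [hae] with x hx using (hF'.tendsto _).comp hx
  refine of_approx hp (h.memLp.of_le_mul (c := K) (hF.continuous.comp_aestronglyMeasurable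
    h.memLp.1) (.of_forall fun x => by simpa [hF0] using hLip (u x) 0)) (hmem _ h.grad_memLp)
    (hmem _ h.grad_memLm) ⟨fun n x => F (φ n x), fun n => ?_, ?_, ?_, ?_⟩
  · exact ⟨hF.comp (hφ n).smooth, (hφ n).compact.comp_left hF0,
      (tsupport_comp_subset hF0 (φ n)).trans (hφ n).support_subset⟩
  · refine tendsto_of_tendsto_of_tendsto_of_le_of_le tendsto_const_nhds
      (by simpa using ENNReal.Tendsto.const_mul h1 (Or.inr (ENNReal.ofReal_ne_top (r := K))))
      (fun _ => zero_le) (fun n => ?_)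
    exact eLpNorm_le_mul_eLpNorm_of_ae_le_mul (.of_forall fun x => hLip _ _) _
  · exact hgrad _ (ENNReal.one_le_ofReal.2 hp) ENNReal.ofReal_ne_top h.grad_memLp h2
  · exact hgrad _ (ENNReal.one_le_ofReal.2 hm) ENNReal.ofReal_ne_top h.grad_memLm h3

/-- Only `∇ζ`, not `ζ`, has compact support, which admits cutoffs equal to `1` near infinity. The
term `u ∇ζ` lies in `L^m` although `u` is only in `L^p`, by Hölder with the complementary exponent
on `∇ζ`. -/
theorem mul_cutoff (hm : 1 ≤ m) (hmp : m ≤ p) {ζ : Eucl N → ℝ} (hζ : ContDiff ℝ ∞ ζ)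
    (hζ1 : ∀ x, |ζ x| ≤ 1) (hζc : HasCompactSupport (∇ ζ)) (h : MemSobolevZero Ω p m u w) :
    MemSobolevZero Ω p m (fun x => ζ x * u x) (fun x => ζ x • w x + u x • ∇ ζ x) := by
  have hp : 1 ≤ p := hm.trans hmp
  have hζ' : ContDiff ℝ 1 ζ := hζ.of_le (by simp)
  have hgζ : ∀ s, MemLp (∇ ζ) s (volume.restrict Ω) := fun s =>
    (hζ'.continuous_gradient.memLp_of_hasCompactSupport hζc).restrict _
  have hmζ : AEStronglyMeasurable ζ (volume.restrict Ω) := hζ.continuous.aestronglyMeasurable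
  have hle : ∀ {E : Type} [NormedAddCommGroup E] [NormedSpace ℝ E] (f : Eucl N → E) (x),
      ‖ζ x • f x‖ ≤ 1 * ‖f x‖ := fun f x => by
    rw [norm_smul]; gcongr; exact hζ1 x
  have hmem : ∀ r, r ≤ ENNReal.ofReal p → MemLp w r (volume.restrict Ω) →
      MemLp (fun x => ζ x • w x + u x • ∇ ζ x) r (volume.restrict Ω) := fun r hr hw => by
    obtain ⟨s, hs⟩ := ENNReal.exists_holderTriple hr
    exact (hw.of_le_mul (hmζ.smul hw.1) (.of_forall (hle w))).add ((hgζ s).smul h.memLp)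
  have hmp' : ENNReal.ofReal m ≤ ENNReal.ofReal p := ENNReal.ofReal_le_ofReal hmp
  obtain ⟨φ, hφ, h1, h2, h3⟩ := h.approx
  have hg : ∀ n x, ∇ (fun y => ζ y * φ n y) x = ζ x • ∇ (φ n) x + φ n x • ∇ ζ x := fun n x =>
    gradient_mul (hζ'.differentiable one_ne_zero x) ((hφ n).differentiable x)
  have hgrad : ∀ r : ℝ≥0∞, 1 ≤ r → r ≤ ENNReal.ofReal p → MemLp w r (volume.restrict Ω) →
      Tendsto (fun n => eLpNorm (fun x => ∇ (φ n) x - w x) r (volume.restrict Ω)) atTop (𝓝 0) →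
      Tendsto (fun n => eLpNorm (fun x => ∇ (fun y => ζ y * φ n y) x
        - (ζ x • w x + u x • ∇ ζ x)) r (volume.restrict Ω)) atTop (𝓝 0) := fun r hr hrp hw hl => by
    obtain ⟨s, hs⟩ := ENNReal.exists_holderTriple hrp
    have hlim : Tendsto (fun n => eLpNorm (fun x => ∇ (φ n) x - w x) r (volume.restrict Ω)
        + eLpNorm (fun x => φ n x - u x) (ENNReal.ofReal p) (volume.restrict Ω)
          * eLpNorm (∇ ζ) s (volume.restrict Ω)) atTop (𝓝 0) := by
      simpa using hl.add (ENNReal.Tendsto.mul_const h1 (Or.inr (hgζ s).2.ne))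
    refine tendsto_of_tendsto_of_tendsto_of_le_of_le tendsto_const_nhds hlim
      (fun _ => zero_le) (fun n => ?_)
    have hsplit : (fun x => ∇ (fun y => ζ y * φ n y) x - (ζ x • w x + u x • ∇ ζ x))
        = (fun x => ζ x • (∇ (φ n) x - w x)) + (fun x => φ n x - u x) • ∇ ζ := by
      ext1 x; simp only [hg, Pi.add_apply, Pi.smul_apply', smul_sub, sub_smul]; abel
    have hd := ((hφ n).memLp (ENNReal.ofReal p)).sub h.memLp
    have hdw := ((hφ n).gradient_memLp r).sub hw
    rw [hsplit]
    refine (eLpNorm_add_le (hmζ.smul hdw.1) (hd.1.smul (hgζ s).1) hr).trans (add_le_add ?_ ?_)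
    · have := eLpNorm_le_mul_eLpNorm_of_ae_le_mul (μ := volume.restrict Ω)
        (.of_forall (hle fun x => ∇ (φ n) x - w x)) r
      rwa [ENNReal.ofReal_one, one_mul] at this
    · exact eLpNorm_smul_le_mul_eLpNorm (hgζ s).1 hd.1
  refine of_approx hp (h.memLp.of_le_mul (hmζ.mul h.memLp.1) (.of_forall (hle u)))
    (hmem _ le_rfl h.grad_memLp) (hmem _ hmp' h.grad_memLm)
    ⟨fun n x => ζ x * φ n x, fun n => ?_, ?_, ?_, ?_⟩
  · exact ⟨hζ.mul (hφ n).smooth, (hφ n).compact.mul_left,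
      (tsupport_mul_subset_right).trans (hφ n).support_subset⟩
  · refine tendsto_of_tendsto_of_tendsto_of_le_of_le tendsto_const_nhds h1
      (fun _ => zero_le) (fun n => ?_)
    simpa [mul_sub] using eLpNorm_le_mul_eLpNorm_of_ae_le_mul (μ := volume.restrict Ω)
        (.of_forall (hle fun x => φ n x - u x)) (ENNReal.ofReal p)
  · exact hgrad _ (ENNReal.one_le_ofReal.2 hp) le_rfl h.grad_memLp h2
  · exact hgrad _ (ENNReal.one_le_ofReal.2 hm) hmp' h.grad_memLm h3

/-- The Sobolev inequality on `W₀^{1,p}(Ω) ∩ D₀^{1,m}(Ω)`. -/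
theorem exists_eLpNorm_le (hp : 1 ≤ p) (hpN : p < N) (Ω : Set (Eucl N)) (m : ℝ) :
    ∃ S : ℝ, 0 < S ∧ ∀ (u : Eucl N → ℝ) (w : Eucl N → Eucl N), MemSobolevZero Ω p m u w →
      eLpNorm u (ENNReal.ofReal (N * p / (N - p))) (volume.restrict Ω)
        ≤ ENNReal.ofReal S * eLpNorm w (ENNReal.ofReal p) (volume.restrict Ω) := by
  have hN : (0 : ℝ) < N := by linarith
  obtain ⟨c, hc⟩ : ∃ c : NNReal, ∀ φ : Eucl N → ℝ, IsTestFunction Ω φ →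
      eLpNorm φ (ENNReal.ofReal (N * p / (N - p))) (volume.restrict Ω)
        ≤ c * eLpNorm (∇ φ) (ENNReal.ofReal p) (volume.restrict Ω) := by
    refine ⟨SNormLESNormFDerivOfEqConst ℝ (volume : Measure (Eucl N)) p.toNNReal,
      fun φ hφ => ?_⟩
    have h := eLpNorm_le_eLpNorm_fderiv_of_eq (μ := (volume : Measure (Eucl N))) hφ.contDiff_one
      hφ.compact (p := p.toNNReal) (p' := (N * p / (N - p)).toNNReal)
      (by simpa using hp) (by simpa using hN) (by
        have : (0 : ℝ) < N - p := by linarith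
        rw [NNReal.coe_inv, Real.coe_toNNReal _ (by positivity), Real.coe_toNNReal _ (by linarith)]
        simp only [finrank_euclideanSpace, Fintype.card_fin]
        field_simp)
    rw [show eLpNorm (fderiv ℝ φ) (p.toNNReal) volume = eLpNorm (∇ φ) (p.toNNReal) volume from
        eLpNorm_congr_norm_ae (.of_forall fun x => (norm_gradient φ x).symm),
      ← eLpNorm_restrict_eq_of_support_subset (s := Ω) (f := ∇ φ)
        ((subset_tsupport _).trans ((tsupport_gradient_subset φ).trans hφ.support_subset))] at h
    exact (eLpNorm_mono_measure _ Measure.restrict_le_self).trans h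
  refine ⟨c + 1, by positivity, fun u w h => ?_⟩
  obtain ⟨φ, hφ, hae, h1, h2, -⟩ := h.exists_ae_approx hp
  have hb : ∀ n, eLpNorm (φ n) (ENNReal.ofReal (N * p / (N - p))) (volume.restrict Ω)
      ≤ c * (eLpNorm (fun x => ∇ (φ n) x - w x) (ENNReal.ofReal p) (volume.restrict Ω)
        + eLpNorm w (ENNReal.ofReal p) (volume.restrict Ω)) := fun n => by
    refine (hc _ (hφ n)).trans (mul_le_mul_right ?_ _)
    have := eLpNorm_add_le (((hφ n).gradient_memLp _).sub h.grad_memLp).1 h.grad_memLp.1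
      (ENNReal.one_le_ofReal.2 hp)
    rwa [sub_add_cancel] at this
  have hlim := ENNReal.Tendsto.const_mul (a := (c : ℝ≥0∞)) (h2.add_const
    (eLpNorm w (ENNReal.ofReal p) (volume.restrict Ω))) (Or.inr ENNReal.coe_ne_top)
  rw [zero_add] at hlim
  -- Fatou's lemma along the almost everywhere convergent approximation.
  calc eLpNorm u (ENNReal.ofReal (N * p / (N - p))) (volume.restrict Ω)
      ≤ liminf (fun n => eLpNorm (φ n) (ENNReal.ofReal (N * p / (N - p))) (volume.restrict Ω))
          atTop := Lp.eLpNorm_lim_le_liminf_eLpNorm (fun n => ((hφ n).memLp 1).1) u hae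
    _ ≤ c * eLpNorm w (ENNReal.ofReal p) (volume.restrict Ω) :=
        (liminf_le_liminf (.of_forall hb)).trans_eq hlim.liminf_eq
    _ ≤ _ := by
        gcongr
        rw [← ENNReal.ofReal_coe_nnreal]
        exact ENNReal.ofReal_le_ofReal (by linarith)

end MemSobolevZero

/-! ### Smooth truncations. -/

/-- A smooth nondecreasing function with slope at most `1` vanishing exactly on `(-∞, 0]`. -/
noncomputable def smoothPosPart (t : ℝ) : ℝ := t * expNegInvGlue t

namespace smoothPosPart

theorem contDiff : ContDiff ℝ ∞ smoothPosPart :=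
  contDiff_id.mul (expNegInvGlue.contDiff (n := ⊤))

theorem hasDerivAt (t : ℝ) : HasDerivAt smoothPosPart ((1 + t⁻¹) * expNegInvGlue t) t := by
  have h := (hasDerivAt_id t).mul (expNegInvGlue.hasDerivAt_polynomial_eval_inv_mul 1 t)
  simp only [Polynomial.eval_one, one_mul, id, Polynomial.derivative_one, sub_zero, mul_one,
    Polynomial.eval_pow, Polynomial.eval_X] at h
  refine h.congr_deriv ?_
  rcases eq_or_ne t 0 with rfl | ht
  · simp
  · field_simp

theorem eq_zero {t : ℝ} (ht : t ≤ 0) : smoothPosPart t = 0 := by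
  simp [smoothPosPart, expNegInvGlue.zero_of_nonpos ht]

theorem deriv_eq_zero {t : ℝ} (ht : t ≤ 0) : deriv smoothPosPart t = 0 := by
  simp [(hasDerivAt t).deriv, expNegInvGlue.zero_of_nonpos ht]

theorem deriv_nonneg (t : ℝ) : 0 ≤ deriv smoothPosPart t := by
  rcases le_or_gt t 0 with ht | ht
  · rw [deriv_eq_zero ht]
  · rw [(hasDerivAt t).deriv]
    have := expNegInvGlue.nonneg t
    positivity

/-- For `t > 0` this is `1 + x ≤ eˣ` at `x = t⁻¹`. -/
theorem deriv_le_one (t : ℝ) : deriv smoothPosPart t ≤ 1 := by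
  rcases le_or_gt t 0 with ht | ht
  · simp [deriv_eq_zero ht]
  · rw [(hasDerivAt t).deriv, expNegInvGlue, if_neg ht.not_ge]
    calc (1 + t⁻¹) * Real.exp (-t⁻¹) ≤ Real.exp t⁻¹ * Real.exp (-t⁻¹) := by
          gcongr
          linarith [Real.add_one_le_exp t⁻¹]
      _ = 1 := by rw [← Real.exp_add]; simp

theorem nonneg (t : ℝ) : 0 ≤ smoothPosPart t := by
  rcases le_or_gt t 0 with ht | ht
  · rw [eq_zero ht]
  · exact mul_nonneg ht.le (expNegInvGlue.nonneg t)

theorem le_mul_deriv {t : ℝ} (ht : 0 ≤ t) : smoothPosPart t ≤ t * deriv smoothPosPart t := by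
  rw [(hasDerivAt t).deriv, smoothPosPart]
  have := expNegInvGlue.nonneg t
  gcongr
  nlinarith [inv_nonneg.2 ht]

theorem le_exp_mul {t : ℝ} (ht : 1 ≤ t) : t ≤ Real.exp 1 * smoothPosPart t := by
  rw [smoothPosPart, expNegInvGlue, if_neg (by linarith)]
  have h : 1 ≤ Real.exp 1 * Real.exp (-t⁻¹) := by
    rw [← Real.exp_add]
    exact Real.one_le_exp (by linarith [inv_le_one_of_one_le₀ ht])
  nlinarith

end smoothPosPart

/-- A smooth odd truncation of `s`, vanishing exactly for `|s| ≤ k`, with slope in `[0, 1]` and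
transition length `δ`. -/
noncomputable def softTrunc (k δ s : ℝ) : ℝ :=
  δ * (smoothPosPart ((s - k) / δ) - smoothPosPart ((-s - k) / δ))

namespace softTrunc

variable {k δ : ℝ}

theorem contDiff : ContDiff ℝ ∞ (softTrunc k δ) := by
  have h := smoothPosPart.contDiff
  unfold softTrunc
  fun_prop

theorem deriv_eq (hδ : δ ≠ 0) (s : ℝ) : deriv (softTrunc k δ) s =
    deriv smoothPosPart ((s - k) / δ) + deriv smoothPosPart ((-s - k) / δ) := by
  have h : ∀ t, HasDerivAt smoothPosPart (deriv smoothPosPart t) t := fun t =>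
    (smoothPosPart.hasDerivAt t).differentiableAt.hasDerivAt
  have h1 := (h ((s - k) / δ)).comp s (((hasDerivAt_id s).sub_const k).div_const δ)
  have h2 := (h ((-s - k) / δ)).comp s (((hasDerivAt_id s).neg.sub_const k).div_const δ)
  refine ((h1.sub h2).const_mul δ).deriv.trans ?_
  field_simp
  ring

theorem neg (s : ℝ) : softTrunc k δ (-s) = -softTrunc k δ s := by
  simp only [softTrunc, neg_neg]; ring

theorem deriv_neg_arg (hδ : δ ≠ 0) (s : ℝ) :
    deriv (softTrunc k δ) (-s) = deriv (softTrunc k δ) s := by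
  simp only [deriv_eq hδ, neg_neg]; ring

theorem eq_of_nonneg (hk : 0 ≤ k) (hδ : 0 < δ) {s : ℝ} (hs : 0 ≤ s) :
    softTrunc k δ s = δ * smoothPosPart ((s - k) / δ) := by
  rw [softTrunc, smoothPosPart.eq_zero (t := (-s - k) / δ)
    (div_nonpos_of_nonpos_of_nonneg (by linarith) hδ.le), sub_zero]

theorem deriv_eq_of_nonneg (hk : 0 ≤ k) (hδ : 0 < δ) {s : ℝ} (hs : 0 ≤ s) :
    deriv (softTrunc k δ) s = deriv smoothPosPart ((s - k) / δ) := by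
  rw [deriv_eq hδ.ne', smoothPosPart.deriv_eq_zero (t := (-s - k) / δ)
    (div_nonpos_of_nonpos_of_nonneg (by linarith) hδ.le), add_zero]

theorem apply_abs (s : ℝ) : softTrunc k δ |s| = softTrunc k δ s ∨
    softTrunc k δ |s| = -softTrunc k δ s := by
  rcases abs_choice s with h | h <;> simp [h, neg]

theorem deriv_abs (hδ : δ ≠ 0) (s : ℝ) :
    deriv (softTrunc k δ) |s| = deriv (softTrunc k δ) s := by
  rcases abs_choice s with h | h <;> simp [h, deriv_neg_arg hδ]

theorem deriv_nonneg (hδ : δ ≠ 0) (s : ℝ) : 0 ≤ deriv (softTrunc k δ) s := by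
  rw [deriv_eq hδ]
  exact add_nonneg (smoothPosPart.deriv_nonneg _) (smoothPosPart.deriv_nonneg _)

theorem deriv_le_one (hk : 0 ≤ k) (hδ : 0 < δ) (s : ℝ) : deriv (softTrunc k δ) s ≤ 1 := by
  rw [← deriv_abs hδ.ne', deriv_eq_of_nonneg hk hδ (abs_nonneg s)]
  exact smoothPosPart.deriv_le_one _

theorem deriv_eq_zero (hk : 0 ≤ k) (hδ : 0 < δ) {s : ℝ} (hs : |s| ≤ k) :
    deriv (softTrunc k δ) s = 0 := by
  rw [← deriv_abs hδ.ne', deriv_eq_of_nonneg hk hδ (abs_nonneg s)]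
  exact smoothPosPart.deriv_eq_zero (div_nonpos_of_nonpos_of_nonneg (by linarith) hδ.le)

theorem abs_eq (hk : 0 ≤ k) (hδ : 0 < δ) (s : ℝ) :
    |softTrunc k δ s| = δ * smoothPosPart ((|s| - k) / δ) := by
  have h := eq_of_nonneg hk hδ (abs_nonneg s)
  have h0 := mul_nonneg hδ.le (smoothPosPart.nonneg ((|s| - k) / δ))
  rcases apply_abs (k := k) (δ := δ) s with h' | h'
  · rw [← h', h, abs_of_nonneg h0]
  · rw [← abs_neg, ← h', h, abs_of_nonneg h0]

/-- This follows from `f(t) ≤ t f'(t)` for the positive part and `|s| - k ≤ |s|`. It bounds the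
undifferentiated factor in the test gradient by the weight `F'` carried by the coercive term. -/
theorem abs_le (hk : 0 ≤ k) (hδ : 0 < δ) (s : ℝ) :
    |softTrunc k δ s| ≤ |s| * deriv (softTrunc k δ) s := by
  rw [abs_eq hk hδ, ← deriv_abs hδ.ne', deriv_eq_of_nonneg hk hδ (abs_nonneg s)]
  rcases le_or_gt |s| k with h | h
  · have h' : (|s| - k) / δ ≤ 0 := div_nonpos_of_nonpos_of_nonneg (by linarith) hδ.le
    rw [smoothPosPart.eq_zero h', smoothPosPart.deriv_eq_zero h']
    simp
  · have h' : 0 ≤ (|s| - k) / δ := div_nonneg (by linarith) hδ.le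
    calc δ * smoothPosPart ((|s| - k) / δ)
        ≤ δ * ((|s| - k) / δ * deriv smoothPosPart ((|s| - k) / δ)) := by
          gcongr; exact smoothPosPart.le_mul_deriv h'
      _ = (|s| - k) * deriv smoothPosPart ((|s| - k) / δ) := by field_simp
      _ ≤ _ := by
          gcongr
          · exact smoothPosPart.deriv_nonneg _
          · linarith

theorem zero : softTrunc k δ 0 = 0 := by simp [softTrunc]

theorem mul_nonneg (hk : 0 ≤ k) (hδ : 0 < δ) (s : ℝ) : 0 ≤ s * softTrunc k δ s := by
  have h : ∀ t, 0 ≤ t → 0 ≤ t * softTrunc k δ t := fun t ht => by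
    rw [eq_of_nonneg hk hδ ht]
    exact _root_.mul_nonneg ht (_root_.mul_nonneg hδ.le (smoothPosPart.nonneg _))
  rcases le_total 0 s with hs | hs
  · exact h s hs
  · simpa [neg] using h (-s) (by linarith)

/-- Beyond the transition layer the truncation is comparable to `|s|` itself, so a bound on the
truncation at level `k` controls `u` above level `k + δ`. -/
theorem le_mul_abs (hk : 0 ≤ k) (hδ : 0 < δ) {s : ℝ} (hs : k + δ ≤ |s|) :
    |s| ≤ Real.exp 1 * ((k + δ) / δ) * |softTrunc k δ s| := by
  rw [abs_eq hk hδ]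
  have h1 := smoothPosPart.le_exp_mul (t := (|s| - k) / δ) (by rw [le_div_iff₀ hδ]; linarith)
  calc |s| ≤ (k + δ) / δ * (|s| - k) := by
        rw [div_mul_eq_mul_div, le_div_iff₀ hδ]
        nlinarith
    _ = (k + δ) * ((|s| - k) / δ) := by field_simp
    _ ≤ (k + δ) * (Real.exp 1 * smoothPosPart ((|s| - k) / δ)) := by gcongr
    _ = _ := by field_simp

end softTrunc

/-! ### Cutoff functions. -/

theorem Real.smoothTransition.exists_abs_deriv_le :
    ∃ K : ℝ, 0 < K ∧ (∀ t, |deriv Real.smoothTransition t| ≤ K) ∧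
      ∀ t, 1 < t → deriv Real.smoothTransition t = 0 := by
  have h1 : ∀ t, 1 < t → deriv Real.smoothTransition t = 0 := fun t ht => by
    rw [Filter.EventuallyEq.deriv_eq (f := fun _ => (1 : ℝ))]
    · simp
    · filter_upwards [lt_mem_nhds ht] with s hs using Real.smoothTransition.one_of_one_le hs.le
  have h0 : ∀ t, t < 0 → deriv Real.smoothTransition t = 0 := fun t ht => by
    rw [Filter.EventuallyEq.deriv_eq (f := fun _ => (0 : ℝ))]
    · simp
    · filter_upwards [gt_mem_nhds ht] with s hs using Real.smoothTransition.zero_of_nonpos hs.le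
  have hc : HasCompactSupport (deriv Real.smoothTransition) :=
    HasCompactSupport.intro (K := Set.Icc 0 1) isCompact_Icc fun t ht => by
      rcases lt_or_ge t 0 with h | h
      · exact h0 t h
      · exact h1 t (lt_of_not_ge fun h' => ht ⟨h, h'⟩)
  obtain ⟨K, hK⟩ := hc.exists_bound_of_continuous
    ((Real.smoothTransition.contDiff (n := 1)).continuous_deriv le_rfl)
  exact ⟨|K| + 1, by positivity, fun t => (hK t).trans (by linarith [le_abs_self K]), h1⟩

/-- A cutoff function: smooth, with values in `[0, 1]`, and with compactly supported gradient
bounded by `B`. -/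
structure IsCutoff {N : ℕ} (B : ℝ) (η : Eucl N → ℝ) : Prop where
  contDiff : ContDiff ℝ ∞ η
  nonneg : ∀ x, 0 ≤ η x
  le_one : ∀ x, η x ≤ 1
  gradient_le : ∀ x, ‖∇ η x‖ ≤ B
  hasCompactSupport : HasCompactSupport (∇ η)

theorem IsCutoff.one {N : ℕ} {B : ℝ} (hB : 0 ≤ B) : IsCutoff B (fun _ : Eucl N => (1 : ℝ)) where
  contDiff := contDiff_const
  nonneg _ := zero_le_one
  le_one _ := le_rfl
  gradient_le x := by simpa using hB
  hasCompactSupport := by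
    rw [gradient_fun_const']
    exact HasCompactSupport.zero

/-- Cutoffs vanishing for `‖x‖² ≤ ρ (2 - 2⁻ʲ)` and equal to `1` for `‖x‖² ≥ ρ (2 - 2⁻ʲ⁻¹)`. -/
theorem exists_isCutoff (N : ℕ) : ∃ K : ℝ, 1 ≤ K ∧ ∀ ρ : ℝ, 1 ≤ ρ → ∀ j : ℕ,
    ∃ η : Eucl N → ℝ, IsCutoff (K * 2 ^ j) η ∧
      (∀ x, η x ≠ 0 ↔ ρ * (2 - (1 / 2) ^ j) < ‖x‖ ^ 2) ∧
      (∀ x, ρ * (2 - (1 / 2) ^ (j + 1)) ≤ ‖x‖ ^ 2 → η x = 1) := by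
  obtain ⟨K, hK0, hK, hK1⟩ := Real.smoothTransition.exists_abs_deriv_le
  refine ⟨8 * K + 1, by linarith, fun ρ hρ j => ?_⟩
  set r : ℝ := (1 / 2) ^ j with hr
  have hr0 : 0 < r := by positivity
  have hr1 : r ≤ 1 := pow_le_one₀ (by norm_num) (by norm_num)
  have hr2 : (1 / 2 : ℝ) ^ (j + 1) = r / 2 := by rw [pow_succ, hr]; ring
  have hrj : (2 : ℝ) ^ j = r⁻¹ := by rw [hr]; simp
  set a := ρ * (2 - r) with ha
  set d := ρ * (r / 2) with hd
  have hd0 : 0 < d := by positivity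
  have hb : ρ * (2 - r / 2) = a + d := by rw [ha, hd]; ring
  -- Working with `‖x‖²` keeps `q` smooth at the origin. It runs from `0` to `1` across the
  -- transition shell.
  set q : Eucl N → ℝ := fun x => (‖x‖ ^ 2 - a) / d with hq
  have hqs : ContDiff ℝ ∞ q := ((contDiff_norm_sq ℝ).sub contDiff_const).div_const d
  have hqg : ∀ x, ∇ q x = (2 / d) • x := fun x => by
    refine HasGradientAt.gradient (hasGradientAt_iff_hasFDerivAt.2 ?_)
    have h := ((hasStrictFDerivAt_norm_sq x).hasFDerivAt.sub_const a).mul_const d⁻¹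
    simp only [← div_eq_mul_inv] at h
    refine h.congr_fderiv ?_
    ext y
    simp only [InnerProductSpace.toDual_apply_apply, inner_smul_left, smul_apply,
      innerSL_apply_apply, smul_eq_mul, nsmul_eq_mul]
    simp [div_eq_inv_mul]
    ring
  have hT : ContDiff ℝ ∞ Real.smoothTransition := Real.smoothTransition.contDiff (n := ⊤)
  have hg : ∀ x, ∇ (fun y => Real.smoothTransition (q y)) x
      = deriv Real.smoothTransition (q x) • ((2 / d) • x) := fun x => by
    rw [← hqg]
    exact gradient_comp (hT.differentiable (by simp) _) (hqs.differentiable (by simp) _)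
  -- Since `ρ ≥ 1`, `‖x‖ > 2ρ` gives `‖x‖² > 2ρ`, beyond the shell. On the ball of radius `2ρ` the
  -- gradient is at most `K (2/d) 2ρ = 8K 2ʲ`, independently of `ρ`.
  have hfar : ∀ x, 2 * ρ < ‖x‖ → ∇ (fun y => Real.smoothTransition (q y)) x = 0 := fun x hx => by
    rw [hg, hK1, zero_smul]
    rw [hq, one_lt_div hd0]
    nlinarith
  refine ⟨fun x => Real.smoothTransition (q x), ⟨hT.comp hqs, fun x => Real.smoothTransition.nonneg _,
    fun x => Real.smoothTransition.le_one _, fun x => ?_, ?_⟩, fun x => ?_, fun x hx => ?_⟩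
  · rcases lt_or_ge (2 * ρ) ‖x‖ with hx | hx
    · rw [hfar x hx, norm_zero]; positivity
    · rw [hg, norm_smul, norm_smul, hrj, Real.norm_eq_abs, Real.norm_of_nonneg (by positivity)]
      calc |deriv Real.smoothTransition (q x)| * (2 / d * ‖x‖)
          ≤ K * (2 / d * (2 * ρ)) := by gcongr; exact hK _
        _ = 8 * K * r⁻¹ := by rw [hd]; field_simp; ring
        _ ≤ _ := by gcongr; linarith
  · exact HasCompactSupport.intro (isCompact_closedBall 0 (2 * ρ)) fun x hx => hfar x (by
      simpa using hx)
  · rw [ne_eq, Real.smoothTransition.zero_iff_nonpos, not_le, hq, lt_div_iff₀ hd0, zero_mul,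
      sub_pos]
  · refine Real.smoothTransition.one_of_one_le ?_
    rw [hq, one_le_div hd0]
    rw [hr2, hb] at hx
    linarith

/-! ### Convexity and pointwise energy estimates. -/

theorem ConvexOn.add_inner_gradient_le {E : Type*} [NormedAddCommGroup E] [InnerProductSpace ℝ E]
    [CompleteSpace E] {f : E → ℝ} (hf : ConvexOn ℝ Set.univ f) {x : E}
    (hx : DifferentiableAt ℝ f x) (y : E) : f x + inner ℝ (∇ f x) (y - x) ≤ f y := by
  have hg : ConvexOn ℝ Set.univ (fun t : ℝ => f (AffineMap.lineMap x y t)) := by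
    exact hf.comp_affineMap (AffineMap.lineMap x y)
  have hl : HasDerivAt (fun t : ℝ => AffineMap.lineMap x y t) (y - x) 0 :=
    AffineMap.hasDerivAt_lineMap
  have hd : HasDerivAt (fun t : ℝ => f (AffineMap.lineMap x y t)) (fderiv ℝ f x (y - x)) 0 := by
    have hx' : HasFDerivAt f (fderiv ℝ f x) (AffineMap.lineMap x y (0 : ℝ)) := by
      simpa using hx.hasFDerivAt
    exact hx'.comp_hasDerivAt 0 hl
  have h := hg.le_slope_of_hasDerivAt (Set.mem_univ 0) (Set.mem_univ 1) one_pos hd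
  simp only [slope_def_field, AffineMap.lineMap_apply_one, AffineMap.lineMap_apply_zero, sub_zero,
    div_one] at h
  rw [inner_gradient_left]
  linarith

/-- Coercivity of the gradient of a convex function with growth of order `r`. -/
theorem ConvexOn.mul_rpow_le_inner_gradient {E : Type*} [NormedAddCommGroup E]
    [InnerProductSpace ℝ E] [CompleteSpace E] {f : E → ℝ} (hf : ConvexOn ℝ Set.univ f)
    (hd : Differentiable ℝ f) {r ν C : ℝ} (hr : 1 < r)
    (hlo : ∀ ξ, ν * ‖ξ‖ ^ r ≤ |f ξ|) (hup : ∀ ξ, |f ξ| ≤ C * ‖ξ‖ ^ r)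
    (hgr : ∀ ξ, ‖∇ f ξ‖ ≤ C * ‖ξ‖ ^ (r - 1)) (ξ : E) :
    ν * ‖ξ‖ ^ r ≤ inner ℝ (∇ f ξ) ξ := by
  have h0 : f 0 = 0 := by
    simpa [Real.zero_rpow (by linarith : r ≠ 0)] using hup 0
  have hg0 : ∇ f 0 = 0 := by
    simpa [Real.zero_rpow (by linarith : r - 1 ≠ 0)] using hgr 0
  -- The growth bounds give `f 0 = 0` and `∇ f 0 = 0`, so the tangent plane at `0` yields `f ≥ 0`
  -- and `|f|` is `f`. The tangent plane at `ξ`, evaluated at `0`, then yields `f ξ ≤ ⟨∇ f ξ, ξ⟩`.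
  have hpos : 0 ≤ f ξ := by simpa [h0, hg0] using hf.add_inner_gradient_le (hd 0) ξ
  have h := hf.add_inner_gradient_le (hd ξ) 0
  rw [zero_sub, inner_neg_right, h0] at h
  have := hlo ξ
  rw [abs_of_nonneg hpos] at this
  linarith

section Young

variable {r η a y δ : ℝ} {n : ℕ}

/-- Compare `y` with `δ η a`: each of the two cases produces one term on the right. In the second,
`r ≤ n` and `η ≤ 1` give `η^(n-1) ≤ η^(r-1)`, which pairs with `a^(r-1)`. -/
theorem young_cutoff (hr : 1 < r) (hn : r ≤ n) (hη : 0 ≤ η) (hη1 : η ≤ 1) (ha : 0 ≤ a)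
    (hy : 0 ≤ y) (hδ : 0 < δ) :
    η ^ (n - 1) * a ^ (r - 1) * y ≤ δ * (η ^ n * a ^ r) + δ ^ (1 - r) * y ^ r := by
  have hn1 : 1 ≤ n := by exact_mod_cast (hr.le.trans hn)
  have hmul : ∀ z : ℝ, 0 ≤ z → z ^ (r - 1) * z = z ^ r := fun z hz => by
    rw [← Real.rpow_add_one' hz (by linarith), sub_add_cancel]
  rcases le_total y (δ * (η * a)) with h | h
  · calc η ^ (n - 1) * a ^ (r - 1) * y ≤ η ^ (n - 1) * a ^ (r - 1) * (δ * (η * a)) := by gcongr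
      _ = δ * ((η ^ (n - 1) * η) * (a ^ (r - 1) * a)) := by ring
      _ = δ * (η ^ n * a ^ r) := by rw [hmul a ha, pow_sub_one_mul (by omega)]
      _ ≤ _ := le_add_of_nonneg_right (by positivity)
  · have h1 : η ^ (n - 1) ≤ η ^ (r - 1) := by
      rw [← Real.rpow_natCast]
      refine Real.rpow_le_rpow_of_exponent_ge' hη hη1 (by linarith) ?_
      rw [Nat.cast_sub hn1]; push_cast; linarith
    calc η ^ (n - 1) * a ^ (r - 1) * y ≤ η ^ (r - 1) * a ^ (r - 1) * y := by gcongr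
      _ = (η * a) ^ (r - 1) * y := by rw [Real.mul_rpow hη ha]
      _ ≤ (y / δ) ^ (r - 1) * y := by
          gcongr
          rw [le_div_iff₀ hδ]; linarith
      _ = δ ^ (1 - r) * y ^ r := by
          rw [Real.div_rpow hy hδ.le, ← hmul y hy, show 1 - r = -(r - 1) by ring,
            Real.rpow_neg hδ.le]
          field_simp
      _ ≤ _ := le_add_of_nonneg_left (by positivity)

theorem add_rpow_le_two_rpow_mul (hr : 0 ≤ r) (ha : 0 ≤ a) (hy : 0 ≤ y) :
    (a + y) ^ r ≤ 2 ^ r * (a ^ r + y ^ r) := by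
  wlog h : a ≤ y generalizing a y
  · rw [add_comm a, add_comm (a ^ r)]
    exact this hy ha (by linarith)
  calc (a + y) ^ r ≤ (2 * y) ^ r := by gcongr; linarith
    _ = 2 ^ r * y ^ r := Real.mul_rpow (by norm_num) hy
    _ ≤ _ := by gcongr; exact le_add_of_nonneg_left (by positivity)

end Young

section Pointwise

variable {E : Type*} [NormedAddCommGroup E] [InnerProductSpace ℝ E]

/-- The pointwise estimate of the principal part tested with `ηⁿ F(u)`. -/
theorem exists_le_inner_test {r ν C : ℝ} {n : ℕ} (hr : 1 < r) (hn : r ≤ n) (hν : 0 < ν)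
    (hC : 0 ≤ C) :
    ∃ K : ℝ, 0 ≤ K ∧ ∀ (A ξ z : E) (η s f f' B : ℝ), ν * ‖ξ‖ ^ r ≤ inner ℝ A ξ →
      ‖A‖ ≤ C * ‖ξ‖ ^ (r - 1) → 0 ≤ η → η ≤ 1 → 0 ≤ f' → |f| ≤ |s| * f' → ‖z‖ ≤ B →
      ν / 2 * (η ^ n * f' * ‖ξ‖ ^ r) - K * (f' * (B * |s|) ^ r)
        ≤ inner ℝ A (η ^ n • (f' • ξ) + f • ((n * η ^ (n - 1)) • z)) := by
  set δ := ν / (2 * (C * n + 1)) with hδ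
  have hδ0 : 0 < δ := by positivity
  refine ⟨C * n * δ ^ (1 - r), by positivity, fun A ξ z η s f f' B h1 h2 hη hη1 hf' hf hz => ?_⟩
  have hB : 0 ≤ B := (norm_nonneg z).trans hz
  have hyoung := young_cutoff hr hn hη hη1 (norm_nonneg ξ) (y := B * |s|) (by positivity) hδ0
  have hcross : |f * ((n * η ^ (n - 1)) * inner ℝ A z)|
      ≤ C * n * f' * (η ^ (n - 1) * ‖ξ‖ ^ (r - 1) * (B * |s|)) := by
    rw [abs_mul, abs_mul, abs_of_nonneg (by positivity : 0 ≤ (n : ℝ) * η ^ (n - 1))]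
    calc |f| * (n * η ^ (n - 1) * |inner ℝ A z|)
        ≤ (|s| * f') * (n * η ^ (n - 1) * ((C * ‖ξ‖ ^ (r - 1)) * B)) := by
          gcongr
          exact (abs_real_inner_le_norm A z).trans (by gcongr)
      _ = _ := by ring
  have hδC : C * n * δ ≤ ν / 2 := by
    rw [hδ, ← mul_div_assoc, div_le_div_iff₀ (by positivity) (by norm_num)]
    nlinarith [mul_nonneg hC (Nat.cast_nonneg (α := ℝ) n)]
  have e1 : C * n * f' * (η ^ (n - 1) * ‖ξ‖ ^ (r - 1) * (B * |s|))
      ≤ C * n * f' * (δ * (η ^ n * ‖ξ‖ ^ r) + δ ^ (1 - r) * (B * |s|) ^ r) := by gcongr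
  have e2 : C * n * δ * (f' * (η ^ n * ‖ξ‖ ^ r)) ≤ ν / 2 * (f' * (η ^ n * ‖ξ‖ ^ r)) := by
    gcongr
  have e3 : η ^ n * f' * (ν * ‖ξ‖ ^ r) ≤ η ^ n * f' * inner ℝ A ξ := by gcongr
  rw [inner_add_right, inner_smul_right, inner_smul_right, inner_smul_right, inner_smul_right]
  have e4 := neg_abs_le (f * ((n * η ^ (n - 1)) * inner ℝ A z))
  linarith

/-- The weights `ηⁿ f'` and `f'` lie in `[0, 1]`, where `t^p ≤ t`; their `p`-th powers are thus
replaced by the first powers that the coercive term provides. -/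
theorem norm_test_rpow_le {p η s f f' B : ℝ} {n : ℕ} {ξ z : E} (hp : 1 ≤ p) (hη : 0 ≤ η)
    (hη1 : η ≤ 1) (hf' : 0 ≤ f') (hf1 : f' ≤ 1) (hf : |f| ≤ |s| * f') (hz : ‖z‖ ≤ B) :
    ‖η ^ n • (f' • ξ) + f • ((n * η ^ (n - 1)) • z)‖ ^ p
      ≤ 2 ^ p * (η ^ n * f' * ‖ξ‖ ^ p + n ^ p * (f' * (B * |s|) ^ p)) := by
  have hB : 0 ≤ B := (norm_nonneg z).trans hz
  have hself : ∀ t : ℝ, 0 ≤ t → t ≤ 1 → t ^ p ≤ t := fun t h0 h1 => by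
    simpa using Real.rpow_le_rpow_of_exponent_ge' h0 h1 zero_le_one hp
  have hηn : η ^ (n - 1) ≤ 1 := pow_le_one₀ hη hη1
  have hnorm : ‖η ^ n • (f' • ξ) + f • ((n * η ^ (n - 1)) • z)‖
      ≤ (η ^ n * f') * ‖ξ‖ + f' * (n * (B * |s|)) := by
    refine (norm_add_le _ _).trans (add_le_add ?_ ?_)
    · rw [norm_smul, norm_smul, Real.norm_of_nonneg (by positivity), Real.norm_of_nonneg hf',
        mul_assoc]
    · rw [norm_smul, norm_smul, Real.norm_eq_abs, Real.norm_of_nonneg (by positivity)]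
      calc |f| * (n * η ^ (n - 1) * ‖z‖) ≤ (|s| * f') * (n * 1 * B) := by gcongr
        _ = _ := by ring
  calc _ ≤ ((η ^ n * f') * ‖ξ‖ + f' * (n * (B * |s|))) ^ p := by gcongr
    _ ≤ 2 ^ p * (((η ^ n * f') * ‖ξ‖) ^ p + (f' * (n * (B * |s|))) ^ p) :=
        add_rpow_le_two_rpow_mul (by linarith) (by positivity) (by positivity)
    _ = 2 ^ p * ((η ^ n * f') ^ p * ‖ξ‖ ^ p + n ^ p * (f' ^ p * (B * |s|) ^ p)) := by
        rw [Real.mul_rpow (by positivity) (by positivity), Real.mul_rpow hf' (by positivity),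
          Real.mul_rpow (x := (n : ℝ)) (by positivity) (by positivity)]
        ring
    _ ≤ _ := by
        gcongr
        · exact hself _ (by positivity) (mul_le_one₀ (pow_le_one₀ hη hη1) hf' hf1)
        · exact hself _ hf' hf1

/-- The pointwise energy estimate for two operators of orders `p` and `m`. -/
theorem exists_norm_test_rpow_le_inner {p m ν C : ℝ} {n : ℕ} (hp : 1 < p) (hm : 1 < m)
    (hpn : p ≤ n) (hmn : m ≤ n) (hν : 0 < ν) (hC : 0 ≤ C) :
    ∃ c K : ℝ, 0 < c ∧ 0 ≤ K ∧ ∀ (A A' ξ z : E) (η s f f' B : ℝ), ν * ‖ξ‖ ^ p ≤ inner ℝ A ξ →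
      ‖A‖ ≤ C * ‖ξ‖ ^ (p - 1) → ν * ‖ξ‖ ^ m ≤ inner ℝ A' ξ → ‖A'‖ ≤ C * ‖ξ‖ ^ (m - 1) →
      0 ≤ η → η ≤ 1 → 0 ≤ f' → f' ≤ 1 → |f| ≤ |s| * f' → ‖z‖ ≤ B →
      ‖η ^ n • (f' • ξ) + f • ((n * η ^ (n - 1)) • z)‖ ^ p
        ≤ c * (inner ℝ A (η ^ n • (f' • ξ) + f • ((n * η ^ (n - 1)) • z))
          + inner ℝ A' (η ^ n • (f' • ξ) + f • ((n * η ^ (n - 1)) • z)))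
          + K * (f' * ((B * |s|) ^ p + (B * |s|) ^ m)) := by
  obtain ⟨K₁, hK₁, h₁⟩ := exists_le_inner_test (E := E) hp hpn hν hC
  obtain ⟨K₂, hK₂, h₂⟩ := exists_le_inner_test (E := E) hm hmn hν hC
  -- Normalised so that `c ν/2 = 2^p`. The coercive term of order `m` is nonnegative and is
  -- discarded.
  set c : ℝ := 2 ^ p * (2 / ν) with hc
  have hc0 : 0 < c := by positivity
  set D : ℝ := 2 ^ p * n ^ p with hD
  have hD0 : 0 ≤ D := by positivity
  refine ⟨c, c * (K₁ + K₂) + D, hc0, by positivity,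
    fun A A' ξ z η s f f' B hA hA₁ hA' hA'₁ hη hη1 hf' hf1 hf hz => ?_⟩
  have hB : 0 ≤ B := (norm_nonneg z).trans hz
  have e1 := h₁ A ξ z η s f f' B hA hA₁ hη hη1 hf' hf hz
  have e2 := h₂ A' ξ z η s f f' B hA' hA'₁ hη hη1 hf' hf hz
  have e3 := norm_test_rpow_le (n := n) (ξ := ξ) hp.le hη hη1 hf' hf1 hf hz
  set W := η ^ n • (f' • ξ) + f • ((n * η ^ (n - 1)) • z)
  have hX' : 0 ≤ ν / 2 * (η ^ n * f' * ‖ξ‖ ^ m) := by positivity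
  have hP : 0 ≤ f' * (B * |s|) ^ p := by positivity
  have hQ : 0 ≤ f' * (B * |s|) ^ m := by positivity
  have hcX : c * (ν / 2 * (η ^ n * f' * ‖ξ‖ ^ p)) = 2 ^ p * (η ^ n * f' * ‖ξ‖ ^ p) := by
    rw [hc]; field_simp
  rw [mul_add f']
  generalize η ^ n * f' * ‖ξ‖ ^ p = X at *
  generalize f' * (B * |s|) ^ p = P at *
  generalize f' * (B * |s|) ^ m = Q at *
  have e4 : c * (ν / 2 * X - K₁ * P - K₂ * Q) ≤ c * (inner ℝ A W + inner ℝ A' W) := by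
    gcongr; linarith
  have e5 : 0 ≤ c * K₁ * Q := by positivity
  have e6 : 0 ≤ c * K₂ * P := by positivity
  have e7 : 0 ≤ D * Q := by positivity
  have e8 : (2 : ℝ) ^ p * (X + n ^ p * P) = 2 ^ p * X + D * P := by rw [hD]; ring
  nlinarith

end Pointwise

/-! ### Fast geometric convergence and integrability of the flux pairing. -/

/-- The ratio `l` with `b l^α = 1` cancels the growth `bʲ`: once `A (Z 0)^α ≤ l`, induction gives `Z
j ≤ Z 0 lʲ`. Dividing by `A + 1` in the threshold covers `A = 0`. -/
theorem tendsto_zero_of_superlinear_recursion {A b α : ℝ} (hA : 0 ≤ A) (hb : 1 < b) (hα : 0 < α) :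
    ∃ θ : ℝ, 0 < θ ∧ ∀ Z : ℕ → ℝ, (∀ j, 0 ≤ Z j) → Z 0 ≤ θ →
      (∀ j, Z (j + 1) ≤ A * b ^ j * Z j ^ (1 + α)) → Tendsto Z atTop (𝓝 0) := by
  have hb0 : 0 < b := by linarith
  set l : ℝ := b ^ (-(1 / α)) with hl
  have hl0 : 0 < l := by positivity
  have hl1 : l < 1 := Real.rpow_lt_one_of_one_lt_of_neg hb (by simpa using hα)
  have hbl : b * l ^ α = 1 := by
    rw [hl, ← Real.rpow_mul hb0.le]
    have : -(1 / α) * α = -1 := by field_simp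
    rw [this, Real.rpow_neg_one, mul_inv_cancel₀ hb0.ne']
  refine ⟨(l / (A + 1)) ^ (1 / α), by positivity, fun Z hZ h0 hrec => ?_⟩
  have hsmall : A * Z 0 ^ α ≤ l := by
    have : Z 0 ^ α ≤ l / (A + 1) := by
      calc Z 0 ^ α ≤ ((l / (A + 1)) ^ (1 / α)) ^ α := by gcongr; exact hZ 0
        _ = l / (A + 1) := by
          rw [← Real.rpow_mul (by positivity), one_div_mul_cancel hα.ne', Real.rpow_one]
    have hZ0 := hZ 0
    calc A * Z 0 ^ α ≤ (A + 1) * (l / (A + 1)) := by gcongr; linarith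
      _ = l := by field_simp
  have hdecay : ∀ j, Z j ≤ Z 0 * l ^ j := fun j => by
    induction j with
    | zero => simp
    | succ j ih =>
      have h1 : (l ^ j) ^ α = (l ^ α) ^ j := by
        rw [← Real.rpow_natCast, ← Real.rpow_mul hl0.le, mul_comm, Real.rpow_mul hl0.le,
          Real.rpow_natCast]
      calc Z (j + 1) ≤ A * b ^ j * Z j ^ (1 + α) := hrec j
        _ ≤ A * b ^ j * (Z 0 * l ^ j) ^ (1 + α) := by gcongr; exact hZ j
        _ = (A * Z 0 ^ α) * (b * l ^ α) ^ j * (Z 0 * l ^ j) := by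
          have h0 := mul_nonneg (hZ 0) (pow_pos hl0 j).le
          rw [Real.rpow_add' h0 (by positivity), Real.rpow_one,
            Real.mul_rpow (hZ 0) (by positivity), h1, mul_pow]
          ring
        _ ≤ l * 1 ^ j * (Z 0 * l ^ j) := by
          rw [hbl]
          have := hZ 0
          gcongr
        _ = Z 0 * l ^ (j + 1) := by rw [one_pow, pow_succ]; ring
  refine tendsto_of_tendsto_of_tendsto_of_le_of_le tendsto_const_nhds ?_ hZ hdecay
  simpa using (tendsto_pow_atTop_nhds_zero_of_lt_one hl0.le hl1).const_mul (Z 0)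

theorem integrable_inner_of_growth {α E : Type*} {_ : MeasurableSpace α} {μ : Measure α}
    [NormedAddCommGroup E] [InnerProductSpace ℝ E] {r C : ℝ} (hr : 1 < r) (hC : 0 ≤ C)
    {A ξ w : α → E} (hA : AEStronglyMeasurable A μ) (hAξ : ∀ x, ‖A x‖ ≤ C * ‖ξ x‖ ^ (r - 1))
    (hξ : MemLp ξ (ENNReal.ofReal r) μ) (hw : MemLp w (ENNReal.ofReal r) μ) :
    Integrable (fun x => (inner ℝ (A x) (w x) : ℝ)) μ := by
  have hint : ∀ {f : α → E}, MemLp f (ENNReal.ofReal r) μ → Integrable (fun x => ‖f x‖ ^ r) μ :=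
    fun hf => by
      simpa [ENNReal.toReal_ofReal (by linarith : 0 ≤ r)] using
        hf.integrable_norm_rpow (by simp; linarith) ENNReal.ofReal_ne_top
  refine (((hint hξ).add (hint hw)).const_mul C).mono' (hA.inner hw.1) (.of_forall fun x => ?_)
  have hy := young_cutoff hr (Nat.le_ceil r) zero_le_one le_rfl (norm_nonneg (ξ x))
    (norm_nonneg (w x)) one_pos
  simp only [one_pow, one_mul, Real.one_rpow] at hy
  calc ‖inner ℝ (A x) (w x)‖ ≤ ‖A x‖ * ‖w x‖ := norm_inner_le_norm _ _
    _ ≤ C * ‖ξ x‖ ^ (r - 1) * ‖w x‖ := by gcongr; exact hAξ x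
    _ = C * (‖ξ x‖ ^ (r - 1) * ‖w x‖) := by ring
    _ ≤ _ := by gcongr; exact hy

/-! ### The energy inequality on superlevel sets. -/

/-- The properties of a weak solution `u`, with `Du` its gradient, `A₁ + A₂` the flux and `g` the
right-hand side, which enter the truncation argument. -/
structure IsEnergySolution {N : ℕ} (Ω : Set (Eucl N)) (p m σ ν C : ℝ) (u : Eucl N → ℝ)
    (Du A₁ A₂ : Eucl N → Eucl N) (g : Eucl N → ℝ) : Prop where
  mem : MemSobolevZero Ω p m u Du
  meas₁ : AEStronglyMeasurable A₁ (volume.restrict Ω)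
  meas₂ : AEStronglyMeasurable A₂ (volume.restrict Ω)
  coercive₁ : ∀ x, ν * ‖Du x‖ ^ p ≤ inner ℝ (A₁ x) (Du x)
  coercive₂ : ∀ x, ν * ‖Du x‖ ^ m ≤ inner ℝ (A₂ x) (Du x)
  growth₁ : ∀ x, ‖A₁ x‖ ≤ C * ‖Du x‖ ^ (p - 1)
  growth₂ : ∀ x, ‖A₂ x‖ ≤ C * ‖Du x‖ ^ (m - 1)
  rhs_le : ∀ x, |g x| ≤ C * |u x| ^ (σ - 1)
  ineq : ∀ (v : Eucl N → ℝ) (Dv : Eucl N → Eucl N), MemSobolevZero Ω p m v Dv →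
    (∀ x, 0 ≤ u x * v x) → (∀ x, u x = 0 → v x = 0) →
    (∫ x in Ω, inner ℝ (A₁ x) (Dv x)) + (∫ x in Ω, inner ℝ (A₂ x) (Dv x))
      ≤ ∫ x in Ω, g x * v x

/-- The integral of `|u|^q` over the part of `{η ≠ 0}` where `|u| > k`. -/
noncomputable def levelEnergy {N : ℕ} (Ω : Set (Eucl N)) (u : Eucl N → ℝ) (q : ℝ)
    (η : Eucl N → ℝ) (k : ℝ) : ℝ :=
  ∫ x in Ω, {x | η x ≠ 0 ∧ k < |u x|}.indicator (fun x => |u x| ^ q) x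

section LevelEnergy

variable {N : ℕ} {Ω : Set (Eucl N)} {u η : Eucl N → ℝ} {q k : ℝ}

theorem levelEnergy_nonneg : 0 ≤ levelEnergy Ω u q η k :=
  integral_nonneg fun x => Set.indicator_nonneg (fun x _ => by positivity) x

theorem nullMeasurableSet_level (hu : AEStronglyMeasurable u (volume.restrict Ω))
    (hη : Continuous η) (k : ℝ) :
    NullMeasurableSet {x | η x ≠ 0 ∧ k < |u x|} (volume.restrict Ω) :=
  (isOpen_ne_fun hη continuous_const).measurableSet.nullMeasurableSet.inter
    (nullMeasurableSet_lt aemeasurable_const hu.norm.aemeasurable)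

theorem integrable_indicator_level (hu : AEStronglyMeasurable u (volume.restrict Ω))
    (hη : Continuous η) (hq : IntegrableOn (fun x => |u x| ^ q) Ω) (k : ℝ) :
    IntegrableOn ({x | η x ≠ 0 ∧ k < |u x|}.indicator (fun x => |u x| ^ q)) Ω :=
  Integrable.indicator₀ hq (nullMeasurableSet_level hu hη k)

/-- Above a positive level every lower power is dominated by the power `q`. This is how terms of
orders `m`, `p` and `σ` are all measured by one energy. -/
theorem rpow_le_rpow_sub_mul {r s : ℝ} (hk : 0 < k) (hks : k ≤ s) (hr : r ≤ q) :
    s ^ r ≤ k ^ (r - q) * s ^ q := by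
  have hs : 0 < s := hk.trans_le hks
  calc s ^ r = s ^ (r - q) * s ^ q := by rw [← Real.rpow_add hs, sub_add_cancel]
    _ ≤ _ := by
      gcongr ?_ * _
      exact Real.rpow_le_rpow_of_nonpos hk hks (by linarith)

end LevelEnergy

theorem MemSobolevZero.exists_integral_rpow_le {N : ℕ} {p : ℝ} (hp : 1 < p) (hpN : p < N)
    (Ω : Set (Eucl N)) (m : ℝ) :
    ∃ S : ℝ, 0 < S ∧ ∀ (u : Eucl N → ℝ) (w : Eucl N → Eucl N), MemSobolevZero Ω p m u w →
      IntegrableOn (fun x => |u x| ^ (N * p / (N - p))) Ω ∧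
      ∫ x in Ω, |u x| ^ (N * p / (N - p))
        ≤ S * (∫ x in Ω, ‖w x‖ ^ p) ^ (N * p / (N - p) / p) := by
  obtain ⟨S, hS, h⟩ := exists_eLpNorm_le hp.le hpN Ω m
  set q : ℝ := N * p / (N - p) with hq
  have hq0 : 0 < q := div_pos (by nlinarith) (by linarith)
  have hp0 : 0 < p := by linarith
  refine ⟨S ^ q, by positivity, fun u w huw => ?_⟩
  have hle := h u w huw
  have hu : MemLp u (ENNReal.ofReal q) (volume.restrict Ω) := ⟨huw.memLp.1,
    hle.trans_lt (ENNReal.mul_lt_top ENNReal.ofReal_lt_top huw.grad_memLp.2)⟩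
  have hint := hu.integrable_norm_rpow (by simpa using hq0) ENNReal.ofReal_ne_top
  rw [ENNReal.toReal_ofReal hq0.le] at hint
  refine ⟨hint, ?_⟩
  rw [hu.eLpNorm_eq_integral_rpow_norm (by simpa using hq0) ENNReal.ofReal_ne_top,
    huw.grad_memLp.eLpNorm_eq_integral_rpow_norm (by simpa using hp0) ENNReal.ofReal_ne_top,
    ← ENNReal.ofReal_mul hS.le, ENNReal.ofReal_le_ofReal_iff (by positivity),
    ENNReal.toReal_ofReal hq0.le, ENNReal.toReal_ofReal hp0.le] at hle
  have hI : 0 ≤ ∫ x in Ω, ‖u x‖ ^ q := by positivity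
  have hJ : 0 ≤ ∫ x in Ω, ‖w x‖ ^ p := by positivity
  calc ∫ x in Ω, |u x| ^ q = ((∫ x in Ω, ‖u x‖ ^ q) ^ q⁻¹) ^ q := by
        rw [← Real.rpow_mul hI, inv_mul_cancel₀ hq0.ne', Real.rpow_one]; rfl
    _ ≤ (S * (∫ x in Ω, ‖w x‖ ^ p) ^ p⁻¹) ^ q := by gcongr
    _ = _ := by
        rw [Real.mul_rpow hS.le (by positivity), ← Real.rpow_mul hJ, inv_mul_eq_div]

namespace IsEnergySolution

variable {N : ℕ} {Ω : Set (Eucl N)} {p m σ ν C q : ℝ} {u : Eucl N → ℝ}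
  {Du A₁ A₂ : Eucl N → Eucl N} {g : Eucl N → ℝ}

theorem memSobolevZero_test (hu : MemSobolevZero Ω p m u Du) (hm : 1 < m) (hmp : m < p) {n : ℕ}
    {B k δ : ℝ} {η : Eucl N → ℝ} (hη : IsCutoff B η) (hk : 0 < k) (hδ : 0 < δ) :
    MemSobolevZero Ω p m (fun x => η x ^ n * softTrunc k δ (u x))
      (fun x => η x ^ n • (deriv (softTrunc k δ) (u x) • Du x)
        + softTrunc k δ (u x) • ((n * η x ^ (n - 1)) • ∇ η x)) := by
  have hg : ∀ x, ∇ (fun y => η y ^ n) x = (n * η x ^ (n - 1)) • ∇ η x := fun x => by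
    have := gradient_comp (F := fun t : ℝ => t ^ n) (f := η) (x := x)
      (differentiableAt_pow n) (hη.contDiff.differentiable (by simp) x)
    simpa using this
  have hg' : ∇ (fun y => η y ^ n) = fun x => (n * η x ^ (n - 1)) • ∇ η x := funext hg
  have h1 := hu.comp (by linarith) hm.le (softTrunc.contDiff (k := k) (δ := δ)) softTrunc.zero
    (K := 1) fun s => by
      rw [abs_of_nonneg (softTrunc.deriv_nonneg hδ.ne' s)]
      exact softTrunc.deriv_le_one hk.le hδ s
  have hc : HasCompactSupport (∇ (fun y => η y ^ n)) := by
    rw [hg']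
    exact hη.hasCompactSupport.mono fun x hx h0 => hx (by simp [h0])
  have h2 := h1.mul_cutoff hm.le hmp.le (hη.contDiff.pow n) (fun x => by
      rw [abs_of_nonneg (pow_nonneg (hη.nonneg x) n)]
      exact pow_le_one₀ (hη.nonneg x) (hη.le_one x)) hc
  rwa [hg'] at h2

/-- The energy inequality on superlevel sets. -/
theorem exists_integral_norm_rpow_le (h : IsEnergySolution Ω p m σ ν C u Du A₁ A₂ g)
    (hm : 1 < m) (hmp : m < p) (hpσ : p < σ) (hσq : σ ≤ q) (hν : 0 < ν) (hC : 0 ≤ C)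
    (hq : IntegrableOn (fun x => |u x| ^ q) Ω) :
    ∃ n : ℕ, ∃ K : ℝ, 0 ≤ K ∧ ∀ (B k δ : ℝ) (η : Eucl N → ℝ), 1 ≤ B → 0 < k → 0 < δ →
      IsCutoff B η → ∃ Dv : Eucl N → Eucl N,
        MemSobolevZero Ω p m (fun x => η x ^ n * softTrunc k δ (u x)) Dv ∧
        ∫ x in Ω, ‖Dv x‖ ^ p
          ≤ K * (B ^ p * (k ^ (p - q) + k ^ (m - q) + k ^ (σ - q))) * levelEnergy Ω u q η k := by
  have hp : 1 < p := hm.trans hmp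
  have hpn : p ≤ (⌈p⌉₊ : ℕ) := Nat.le_ceil p
  -- With `n ≥ 2` the factor `η^(n-1)` in the gradient also vanishes where `η = 0`.
  have hn2 : 2 ≤ ⌈p⌉₊ := Nat.lt_ceil.2 (by simpa using hp)
  obtain ⟨c, K, hc, hK, hpt⟩ := exists_norm_test_rpow_le_inner (E := Eucl N) hp hm hpn
    (hmp.le.trans hpn) hν hC
  generalize ⌈p⌉₊ = n at hpn hn2 hpt
  refine ⟨n, c * C + K, by positivity, fun B k δ η hB hk hδ hη => ?_⟩
  set Dv : Eucl N → Eucl N := fun x => η x ^ n • (deriv (softTrunc k δ) (u x) • Du x)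
        + softTrunc k δ (u x) • ((n * η x ^ (n - 1)) • ∇ η x) with hDv
  have hmem : MemSobolevZero Ω p m (fun x => η x ^ n * softTrunc k δ (u x)) Dv :=
    memSobolevZero_test h.mem hm hmp hη hk hδ
  refine ⟨Dv, hmem, ?_⟩
  set T := B ^ p * (k ^ (p - q) + k ^ (m - q) + k ^ (σ - q)) with hT
  set A := {x | η x ≠ 0 ∧ k < |u x|} with hA
  set d : Eucl N → ℝ := A.indicator (fun x => |u x| ^ q) with hd
  have hd0 : ∀ x, 0 ≤ d x := fun x => Set.indicator_nonneg (fun x _ => by positivity) x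
  have hdint : IntegrableOn d Ω :=
    integrable_indicator_level h.mem.memLp.1 hη.contDiff.continuous hq k
  have hB0 : 0 < B := by linarith
  have hT0 : 0 ≤ T := by positivity
  have hoff : ∀ x, x ∉ A → Dv x = 0 ∧ η x ^ n * softTrunc k δ (u x) = 0 := fun x hx => by
    by_cases hηx : η x = 0
    · simp [hDv, hηx, show n ≠ 0 by omega, show n - 1 ≠ 0 by omega]
    · have hk' : |u x| ≤ k := not_lt.1 fun h' => hx ⟨hηx, h'⟩
      have h0 := softTrunc.deriv_eq_zero hk.le hδ hk'
      have h1 : softTrunc k δ (u x) = 0 := by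
        have := softTrunc.abs_le hk.le hδ (u x)
        rw [h0, mul_zero] at this
        exact abs_nonpos_iff.1 this
      simp [hDv, h0, h1]
  have hpoint : ∀ x, ‖Dv x‖ ^ p
      ≤ c * (inner ℝ (A₁ x) (Dv x) + inner ℝ (A₂ x) (Dv x)) + K * T * d x := fun x => by
    by_cases hx : x ∈ A
    · refine (hpt (A₁ x) (A₂ x) (Du x) (∇ η x) (η x) (u x) _ _ B (h.coercive₁ x) (h.growth₁ x)
        (h.coercive₂ x) (h.growth₂ x) (hη.nonneg x) (hη.le_one x)
        (softTrunc.deriv_nonneg hδ.ne' _) (softTrunc.deriv_le_one hk.le hδ _)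
        (softTrunc.abs_le hk.le hδ _) (hη.gradient_le x)).trans ?_
      refine add_le_add le_rfl ?_
      rw [mul_assoc]
      refine mul_le_mul_of_nonneg_left ?_ hK
      have hBm : B ^ m ≤ B ^ p := Real.rpow_le_rpow_of_exponent_le hB hmp.le
      have e1 := rpow_le_rpow_sub_mul (q := q) hk hx.2.le (by linarith : p ≤ q)
      have e2 := rpow_le_rpow_sub_mul (q := q) hk hx.2.le (by linarith : m ≤ q)
      rw [hd, Set.indicator_of_mem hx, Real.mul_rpow hB0.le (abs_nonneg _),
        Real.mul_rpow hB0.le (abs_nonneg _)]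
      calc _ ≤ 1 * (B ^ p * (k ^ (p - q) * |u x| ^ q) + B ^ p * (k ^ (m - q) * |u x| ^ q)) := by
            gcongr
            exact softTrunc.deriv_le_one hk.le hδ _
        _ = B ^ p * (k ^ (p - q) + k ^ (m - q)) * |u x| ^ q := by ring
        _ ≤ T * |u x| ^ q := by
            rw [hT, mul_add _ (_ + _)]
            gcongr
            exact le_add_of_nonneg_right (by positivity)
    · rw [(hoff x hx).1, hd, Set.indicator_of_notMem hx]
      simp [Real.zero_rpow (by linarith : p ≠ 0)]
  have hrhs : ∀ x, g x * (η x ^ n * softTrunc k δ (u x)) ≤ C * T * d x := fun x => by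
    by_cases hx : x ∈ A
    · have hF : |softTrunc k δ (u x)| ≤ |u x| := (softTrunc.abs_le hk.le hδ _).trans
        (mul_le_of_le_one_right (abs_nonneg _) (softTrunc.deriv_le_one hk.le hδ _))
      have hηn : |η x ^ n| ≤ 1 := by
        rw [abs_of_nonneg (pow_nonneg (hη.nonneg x) n)]
        exact pow_le_one₀ (hη.nonneg x) (hη.le_one x)
      have e1 := rpow_le_rpow_sub_mul (q := q) hk hx.2.le hσq
      rw [hd, Set.indicator_of_mem hx]
      calc _ ≤ |g x| * (|η x ^ n| * |softTrunc k δ (u x)|) := by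
            rw [← abs_mul, ← abs_mul]; exact le_abs_self _
        _ ≤ (C * |u x| ^ (σ - 1)) * (1 * |u x|) := by
            gcongr
            exact h.rhs_le x
        _ = C * |u x| ^ σ := by
            rw [one_mul, mul_assoc, ← Real.rpow_add_one' (abs_nonneg _) (by linarith),
              sub_add_cancel]
        _ ≤ C * (T * |u x| ^ q) := by
            gcongr
            refine e1.trans ?_
            gcongr
            calc k ^ (σ - q) ≤ 1 * (k ^ (p - q) + k ^ (m - q) + k ^ (σ - q)) := by
                  rw [one_mul]; exact le_add_of_nonneg_left (by positivity)
              _ ≤ T := by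
                  rw [hT]
                  gcongr
                  exact Real.one_le_rpow hB (by linarith)
        _ = _ := by ring
    · rw [(hoff x hx).2, hd, Set.indicator_of_notMem hx]
      simp
  have hi1 := integrable_inner_of_growth hp hC h.meas₁ h.growth₁ h.mem.grad_memLp hmem.grad_memLp
  have hi2 := integrable_inner_of_growth hm hC h.meas₂ h.growth₂ h.mem.grad_memLm hmem.grad_memLm
  -- The test function is admissible: it has the sign of `u` and vanishes with it.
  have hineq := h.ineq _ Dv hmem (fun x => by
      have := mul_nonneg (pow_nonneg (hη.nonneg x) n) (softTrunc.mul_nonneg hk.le hδ (u x))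
      linarith) (fun x hx => by simp [hx, softTrunc.zero])
  have hgv : ∫ x in Ω, g x * (η x ^ n * softTrunc k δ (u x)) ≤ C * T * ∫ x in Ω, d x := by
    rw [← integral_const_mul]
    -- A non-integrable product would have integral `0` by convention, and the bound is nonnegative,
    -- so integrability need not be shown.
    by_cases hi : IntegrableOn (fun x => g x * (η x ^ n * softTrunc k δ (u x))) Ω
    · exact integral_mono hi (hdint.const_mul _) hrhs
    · rw [integral_undef hi]
      exact integral_nonneg fun x => mul_nonneg (by positivity) (hd0 x)
  have hDvint : IntegrableOn (fun x => ‖Dv x‖ ^ p) Ω := by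
    have := hmem.grad_memLp.integrable_norm_rpow (by simp; linarith) ENNReal.ofReal_ne_top
    rwa [ENNReal.toReal_ofReal (by linarith)] at this
  have hi12 : IntegrableOn (fun x => c * (inner ℝ (A₁ x) (Dv x) + inner ℝ (A₂ x) (Dv x))) Ω :=
    (hi1.add hi2).const_mul c
  calc ∫ x in Ω, ‖Dv x‖ ^ p
      ≤ ∫ x in Ω, (c * (inner ℝ (A₁ x) (Dv x) + inner ℝ (A₂ x) (Dv x)) + K * T * d x) :=
        integral_mono hDvint (hi12.add (hdint.const_mul _)) hpoint
    _ = c * ((∫ x in Ω, inner ℝ (A₁ x) (Dv x)) + ∫ x in Ω, inner ℝ (A₂ x) (Dv x))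
        + K * T * ∫ x in Ω, d x := by
        rw [integral_add hi12 (hdint.const_mul _), integral_const_mul,
          integral_const_mul, integral_add hi1 hi2]
    _ ≤ c * (C * T * ∫ x in Ω, d x) + K * T * ∫ x in Ω, d x := by
        gcongr
        exact hineq.trans hgv
    _ = (c * C + K) * T * levelEnergy Ω u q η k := by rw [levelEnergy]; ring

end IsEnergySolution

/-! ### De Giorgi iteration, boundedness and decay. -/

namespace IsEnergySolution

variable {N : ℕ} {Ω : Set (Eucl N)} {p m σ ν C : ℝ} {u : Eucl N → ℝ}
  {Du A₁ A₂ : Eucl N → Eucl N} {g : Eucl N → ℝ}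

/-- One step of the De Giorgi iteration. -/
theorem exists_levelEnergy_le (h : IsEnergySolution Ω p m σ ν C u Du A₁ A₂ g)
    (hm : 1 < m) (hmp : m < p) (hpN : p < N) (hpσ : p < σ) {q : ℝ} (hq : q = N * p / (N - p))
    (hσq : σ ≤ q) (hν : 0 < ν) (hC : 0 ≤ C) :
    ∃ K : ℝ, 0 ≤ K ∧ ∀ (B k δ : ℝ) (η η' : Eucl N → ℝ), 1 ≤ B → 0 < k → 0 < δ →
      IsCutoff B η → Continuous η' → (∀ x, η' x ≠ 0 → η x = 1) →
      levelEnergy Ω u q η' (k + δ) ≤ K * ((k + δ) / δ) ^ q *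
        ((B ^ p * (k ^ (p - q) + k ^ (m - q) + k ^ (σ - q))) * levelEnergy Ω u q η k)
          ^ (q / p) := by
  have hp : 1 < p := hm.trans hmp
  have hq0 : 0 < q := by linarith
  obtain ⟨S, hS, hSob⟩ := MemSobolevZero.exists_integral_rpow_le hp hpN Ω m
  rw [← hq] at hSob
  have huq := (hSob u Du h.mem).1
  obtain ⟨n, K, hK, hen⟩ := h.exists_integral_norm_rpow_le hm hmp hpσ hσq hν hC huq
  refine ⟨Real.exp 1 ^ q * S * K ^ (q / p), by positivity,
    fun B k δ η η' hB hk hδ hη hη' hηη' => ?_⟩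
  obtain ⟨Dv, hv, hDv⟩ := hen B k δ η hB hk hδ hη
  obtain ⟨hvint, hvle⟩ := hSob _ Dv hv
  set T := B ^ p * (k ^ (p - q) + k ^ (m - q) + k ^ (σ - q)) with hT
  have hT0 : 0 ≤ T := by positivity
  have hE0 : 0 ≤ levelEnergy Ω u q η k := levelEnergy_nonneg
  -- Where `η' ≠ 0` the old cutoff is `1`, and above `k + δ` the truncation is comparable to `|u|`;
  -- the new energy is thus bounded by the quantity in the Sobolev inequality.
  have hpoint : ∀ x, {x | η' x ≠ 0 ∧ k + δ < |u x|}.indicator (fun x => |u x| ^ q) x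
      ≤ (Real.exp 1 * ((k + δ) / δ)) ^ q * |η x ^ n * softTrunc k δ (u x)| ^ q := fun x => by
    by_cases hx : x ∈ {x | η' x ≠ 0 ∧ k + δ < |u x|}
    · rw [Set.indicator_of_mem hx, hηη' x hx.1, one_pow, one_mul,
        ← Real.mul_rpow (by positivity) (abs_nonneg _)]
      gcongr
      exact softTrunc.le_mul_abs hk.le hδ hx.2.le
    · rw [Set.indicator_of_notMem hx]
      positivity
  calc levelEnergy Ω u q η' (k + δ)
      ≤ ∫ x in Ω, (Real.exp 1 * ((k + δ) / δ)) ^ q * |η x ^ n * softTrunc k δ (u x)| ^ q :=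
        integral_mono (integrable_indicator_level h.mem.memLp.1 hη' huq _)
          (hvint.const_mul _) hpoint
    _ = (Real.exp 1 * ((k + δ) / δ)) ^ q * ∫ x in Ω, |η x ^ n * softTrunc k δ (u x)| ^ q :=
        integral_const_mul _ _
    _ ≤ (Real.exp 1 * ((k + δ) / δ)) ^ q * (S * (∫ x in Ω, ‖Dv x‖ ^ p) ^ (q / p)) := by gcongr
    _ ≤ (Real.exp 1 * ((k + δ) / δ)) ^ q *
          (S * (K * T * levelEnergy Ω u q η k) ^ (q / p)) := by gcongr
    _ = _ := by
        rw [mul_assoc K, Real.mul_rpow hK (by positivity),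
          Real.mul_rpow (by positivity) (by positivity)]
        ring

/-- Smallness of the energy above the level `k` forces the bound `2k`. -/
theorem exists_ae_abs_le (h : IsEnergySolution Ω p m σ ν C u Du A₁ A₂ g)
    (hm : 1 < m) (hmp : m < p) (hpN : p < N) (hpσ : p < σ) {q : ℝ} (hq : q = N * p / (N - p))
    (hσq : σ ≤ q) (hν : 0 < ν) (hC : 0 ≤ C) {κ B : ℝ} (hκ : 0 < κ) (hB : 1 ≤ B) :
    ∃ θ : ℝ, 0 < θ ∧ ∀ (k : ℝ) (η : ℕ → Eucl N → ℝ), κ ≤ k →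
      (∀ j, IsCutoff (B * 2 ^ j) (η j)) → (∀ j x, η (j + 1) x ≠ 0 → η j x = 1) →
      levelEnergy Ω u q (η 0) k ≤ θ →
      ∀ᵐ x ∂volume.restrict Ω, (∀ j, η j x ≠ 0) → |u x| ≤ 2 * k := by
  have hp : 1 < p := hm.trans hmp
  have hp0 : 0 < p := by linarith
  have hq0 : 0 < q := by linarith
  obtain ⟨K, hK, hstep⟩ := h.exists_levelEnergy_le hm hmp hpN hpσ hq hσq hν hC
  have huq := ((MemSobolevZero.exists_integral_rpow_le hp hpN Ω m).choose_spec.2 u Du h.mem).1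
  rw [← hq] at huq
  -- The exponents are nonpositive, so `Λ` bounds the level-dependent factor for all levels `≥ κ`.
  set Λ : ℝ := κ ^ (p - q) + κ ^ (m - q) + κ ^ (σ - q) with hΛ
  have hΛ0 : 0 ≤ Λ := by positivity
  have hα : 0 < q / p - 1 := by
    rw [sub_pos, one_lt_div hp0]; linarith
  -- In the base, one `2^q` comes from `(k + δ)/δ ≤ 4 · 2ʲ`, the other from the cutoff gradients of
  -- size `B 2ʲ`, raised to `p` and then to `q/p`.
  obtain ⟨θ, hθ, hrec⟩ := tendsto_zero_of_superlinear_recursion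
    (A := K * 4 ^ q * (B ^ p * Λ) ^ (q / p)) (b := (2 : ℝ) ^ q * 2 ^ q) (α := q / p - 1)
    (by positivity) (one_lt_mul_of_lt_of_le (Real.one_lt_rpow (by norm_num) hq0)
      (Real.one_le_rpow (by norm_num) hq0.le)) hα
  refine ⟨θ, hθ, fun k η hk hη hηη hsmall => ?_⟩
  have hk0 : 0 < k := hκ.trans_le hk
  set lev : ℕ → ℝ := fun j => k * (2 - (1 / 2) ^ j) with hlev
  have hpow1 : ∀ j : ℕ, (1 / 2 : ℝ) ^ j ≤ 1 := fun j =>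
    pow_le_one₀ (by norm_num) (by norm_num)
  have hlevk : ∀ j, k ≤ lev j := fun j => by
    rw [hlev]; nlinarith [hpow1 j]
  have hlev2 : ∀ j, lev j ≤ 2 * k := fun j => by
    have : (0 : ℝ) < (1 / 2) ^ j := by positivity
    rw [hlev]; nlinarith
  set Z : ℕ → ℝ := fun j => levelEnergy Ω u q (η j) (lev j) with hZ
  have hZlim : Tendsto Z atTop (𝓝 0) := by
    refine hrec Z (fun j => levelEnergy_nonneg) ?_ fun j => ?_
    · have : lev 0 = k := by rw [hlev]; norm_num
      rw [hZ]; simpa only [this] using hsmall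
    · set δ : ℝ := k * (1 / 2) ^ (j + 1) with hδ
      have hδ0 : 0 < δ := by positivity
      have hlevδ : lev (j + 1) = lev j + δ := by
        simp only [hlev, hδ, pow_succ]; ring
      have hl0 : 0 < lev j := hk0.trans_le (hlevk j)
      have h2j : (1 : ℝ) ≤ 2 ^ j := one_le_pow₀ (by norm_num)
      have hZ0 : 0 ≤ Z j := levelEnergy_nonneg
      have hratio : (lev j + δ) / δ ≤ 4 * 2 ^ j := by
        rw [← hlevδ, div_le_iff₀ hδ0, hδ]
        have : (4 : ℝ) * 2 ^ j * (k * (1 / 2) ^ (j + 1)) = 2 * k := by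
          rw [pow_succ]
          have : (2 : ℝ) ^ j * (1 / 2) ^ j = 1 := by rw [← mul_pow]; norm_num
          linear_combination (2 * k) * this
        rw [this]
        exact hlev2 _
      have hΛj : lev j ^ (p - q) + lev j ^ (m - q) + lev j ^ (σ - q) ≤ Λ := by
        have hκj := hk.trans (hlevk j)
        refine add_le_add (add_le_add ?_ ?_) ?_ <;>
          exact Real.rpow_le_rpow_of_nonpos hκ hκj (by linarith)
      have hq2 : ∀ t : ℝ, 0 ≤ t → (t ^ p) ^ (q / p) = t ^ q := fun t ht => by
        rw [← Real.rpow_mul ht, mul_div_cancel₀ _ hp0.ne']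
      have h2jq : ((2 : ℝ) ^ j) ^ q = (2 ^ q) ^ j := by
        rw [← Real.rpow_natCast, ← Real.rpow_mul (by norm_num), mul_comm,
          Real.rpow_mul (by norm_num), Real.rpow_natCast]
      calc Z (j + 1) = levelEnergy Ω u q (η (j + 1)) (lev j + δ) := by rw [hZ, ← hlevδ]
        _ ≤ K * ((lev j + δ) / δ) ^ q * (((B * 2 ^ j) ^ p *
              (lev j ^ (p - q) + lev j ^ (m - q) + lev j ^ (σ - q))) * Z j) ^ (q / p) :=
            hstep _ _ _ _ _ (one_le_mul_of_one_le_of_one_le hB h2j) hl0 hδ0 (hη j)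
              (hη (j + 1)).contDiff.continuous (hηη j)
        _ ≤ K * (4 * 2 ^ j) ^ q * (((B * 2 ^ j) ^ p * Λ) * Z j) ^ (q / p) := by gcongr
        _ = K * (4 ^ q * (2 ^ j) ^ q) *
              ((B ^ p * Λ) ^ (q / p) * (2 ^ j) ^ q * Z j ^ (q / p)) := by
            rw [Real.mul_rpow (x := 4) (by norm_num) (by positivity),
              Real.mul_rpow (x := B) (by positivity) (by positivity), mul_right_comm (B ^ p),
              mul_right_comm (B ^ p * Λ), mul_assoc (B ^ p * Λ),
              Real.mul_rpow (x := B ^ p * Λ) (by positivity) (by positivity),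
              Real.mul_rpow (x := Z j) hZ0 (by positivity), hq2 _ (by positivity)]
            ring
        _ = _ := by
            rw [h2jq, mul_pow, add_sub_cancel]
            ring
  -- This set lies in every level set of the iteration, so its energy is below every `Z j` and hence
  -- zero.
  set A : Set (Eucl N) := {x | (∀ j, η j x ≠ 0) ∧ 2 * k < |u x|} with hA
  have hAm : NullMeasurableSet A (volume.restrict Ω) := by
    have hη0 : MeasurableSet {x | ∀ j, η j x ≠ 0} := by
      rw [Set.ofPred_forall]
      exact .iInter fun j => (isOpen_ne_fun (hη j).contDiff.continuous
        continuous_const).measurableSet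
    exact hη0.nullMeasurableSet.inter
      (nullMeasurableSet_lt aemeasurable_const h.mem.memLp.1.norm.aemeasurable)
  have hAint : IntegrableOn (A.indicator fun x => |u x| ^ q) Ω := Integrable.indicator₀ huq hAm
  have hA0 : ∀ x, 0 ≤ A.indicator (fun x => |u x| ^ q) x := fun x =>
    Set.indicator_nonneg (fun x _ => by positivity) x
  have hle : ∀ j, ∫ x in Ω, A.indicator (fun x => |u x| ^ q) x ≤ Z j := fun j => by
    refine integral_mono hAint (integrable_indicator_level h.mem.memLp.1
      (hη j).contDiff.continuous huq _) fun x => ?_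
    have hsub : A ⊆ {x | η j x ≠ 0 ∧ lev j < |u x|} :=
      fun x hx => ⟨hx.1 j, (hlev2 j).trans_lt hx.2⟩
    exact Set.indicator_le_indicator_of_subset hsub (fun x => by positivity) x
  have hzero : ∫ x in Ω, A.indicator (fun x => |u x| ^ q) x = 0 :=
    le_antisymm (ge_of_tendsto' hZlim hle) (integral_nonneg hA0)
  rw [integral_eq_zero_iff_of_nonneg hA0 hAint] at hzero
  filter_upwards [hzero] with x hx hηx
  by_contra! hux
  rw [Set.indicator_of_mem (show x ∈ A from ⟨hηx, hux⟩)] at hx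
  have : 0 < |u x| := by linarith
  exact (Real.rpow_pos_of_pos this q).ne' hx

/-- The solution is small at infinity. -/
theorem exists_ae_abs_le_of_le_norm (h : IsEnergySolution Ω p m σ ν C u Du A₁ A₂ g)
    (hm : 1 < m) (hmp : m < p) (hpN : p < N) (hpσ : p < σ) {q : ℝ} (hq : q = N * p / (N - p))
    (hσq : σ ≤ q) (hν : 0 < ν) (hC : 0 ≤ C) {ε : ℝ} (hε : 0 < ε) :
    ∃ R : ℝ, ∀ᵐ x ∂volume.restrict Ω, R ≤ ‖x‖ → |u x| ≤ ε := by
  have hp : 1 < p := hm.trans hmp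
  have huq := ((MemSobolevZero.exists_integral_rpow_le hp hpN Ω m).choose_spec.2 u Du h.mem).1
  rw [← hq] at huq
  obtain ⟨B, hB, hcut⟩ := exists_isCutoff N
  obtain ⟨θ, hθ, hsmall⟩ := h.exists_ae_abs_le hm hmp hpN hpσ hq hσq hν hC (half_pos hε) hB
  choose η hη hη0 hη1 using fun n : ℕ => hcut (n + 1) (by simp)
  -- The level stays fixed while the supports of the cutoffs leave every bounded set; `|u|^q`
  -- dominates.
  have hlim : Tendsto (fun n => levelEnergy Ω u q (η n 0) (ε / 2)) atTop (𝓝 (∫ x in Ω, 0)) := by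
    refine tendsto_integral_of_dominated_convergence (fun x => |u x| ^ q)
      (fun n => (integrable_indicator_level h.mem.memLp.1 (hη n 0).contDiff.continuous huq _).1)
      huq (fun n => .of_forall fun x => ?_) (.of_forall fun x => ?_)
    · rw [Real.norm_of_nonneg (Set.indicator_nonneg (fun x _ => by positivity) x)]
      exact Set.indicator_le_self' (fun x _ => by positivity) x
    · refine tendsto_const_nhds.congr' ?_
      filter_upwards [eventually_ge_atTop ⌈‖x‖ ^ 2⌉₊] with n hn
      rw [Set.indicator_of_notMem]
      rintro ⟨h0, -⟩
      rw [hη0] at h0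
      have := Nat.ceil_le.1 hn
      norm_num at h0
      linarith
  rw [integral_zero] at hlim
  obtain ⟨n, hn⟩ := (hlim.eventually (gt_mem_nhds hθ)).exists
  have hae := hsmall (ε / 2) (η n) le_rfl (hη n) (fun j x hx => hη1 n j x ((hη0 n _ x).1 hx).le)
    hn.le
  -- With `ρ = n + 1 ≥ 1`, `‖x‖ ≥ 2ρ` gives `‖x‖² ≥ 2ρ > ρ (2 - 2⁻ʲ)`, so no cutoff of the family
  -- vanishes at `x`.
  refine ⟨2 * (n + 1), ?_⟩
  filter_upwards [hae] with x hx hRx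
  refine (hx fun j => (hη0 n j x).2 ?_).trans_eq (by ring)
  have hj : (0 : ℝ) < (1 / 2) ^ j := by positivity
  have hn0 : (0 : ℝ) ≤ n := Nat.cast_nonneg n
  nlinarith

/-- The solution is bounded. -/
theorem memLp_top (h : IsEnergySolution Ω p m σ ν C u Du A₁ A₂ g)
    (hm : 1 < m) (hmp : m < p) (hpN : p < N) (hpσ : p < σ) {q : ℝ} (hq : q = N * p / (N - p))
    (hσq : σ ≤ q) (hν : 0 < ν) (hC : 0 ≤ C) : MemLp u ⊤ (volume.restrict Ω) := by
  have hp : 1 < p := hm.trans hmp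
  have huq := ((MemSobolevZero.exists_integral_rpow_le hp hpN Ω m).choose_spec.2 u Du h.mem).1
  rw [← hq] at huq
  obtain ⟨θ, hθ, hsmall⟩ := h.exists_ae_abs_le hm hmp hpN hpσ hq hσq hν hC one_pos le_rfl
  have hlim : Tendsto (fun n : ℕ => levelEnergy Ω u q (fun _ => 1) (n + 1)) atTop
      (𝓝 (∫ x in Ω, 0)) := by
    refine tendsto_integral_of_dominated_convergence (fun x => |u x| ^ q)
      (fun n => (integrable_indicator_level h.mem.memLp.1 continuous_const huq _).1)
      huq (fun n => .of_forall fun x => ?_) (.of_forall fun x => ?_)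
    · rw [Real.norm_of_nonneg (Set.indicator_nonneg (fun x _ => by positivity) x)]
      exact Set.indicator_le_self' (fun x _ => by positivity) x
    · refine tendsto_const_nhds.congr' ?_
      filter_upwards [eventually_ge_atTop ⌈|u x|⌉₊] with n hn
      rw [Set.indicator_of_notMem]
      rintro ⟨-, h0⟩
      have := Nat.ceil_le.1 hn
      linarith
  rw [integral_zero] at hlim
  obtain ⟨n, hn⟩ := (hlim.eventually (gt_mem_nhds hθ)).exists
  -- All cutoffs are constantly `1`; smallness comes from the height of the level alone.
  have hae := hsmall (n + 1) (fun _ _ => 1) (by simp) (fun j => IsCutoff.one (by positivity))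
    (fun _ _ _ => rfl) hn.le
  refine memLp_top_of_bound h.mem.memLp.1 (2 * (n + 1)) ?_
  filter_upwards [hae] with x hx using hx fun _ => one_ne_zero

end IsEnergySolution

/-! ### From weak solutions to the truncation argument, and conclusion. -/

theorem MeasureTheory.MemLp.of_memLp_top {α E : Type*} {_ : MeasurableSpace α} {μ : Measure α}
    [NormedAddCommGroup E] {f : α → E} {p q : ℝ} (hp : 0 < p) (hpq : p ≤ q)
    (hf : MemLp f (ENNReal.ofReal p) μ) (hf' : MemLp f ⊤ μ) : MemLp f (ENNReal.ofReal q) μ := by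
  have hint := hf.integrable_norm_rpow (by simpa using hp) ENNReal.ofReal_ne_top
  rw [ENNReal.toReal_ofReal hp.le] at hint
  rw [← integrable_norm_rpow_iff hf.1 (by simp; linarith) ENNReal.ofReal_ne_top,
    ENNReal.toReal_ofReal (by linarith)]
  set K := (eLpNorm f ⊤ μ).toReal
  have hK : ∀ᵐ x ∂μ, ‖f x‖ ≤ K := by
    filter_upwards [enorm_ae_le_eLpNormEssSup f μ] with x hx
    rw [← eLpNorm_exponent_top] at hx
    exact (toReal_enorm (f x)).symm.trans_le (ENNReal.toReal_mono hf'.2.ne hx)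
  refine (hint.const_mul (K ^ (q - p))).mono'
    (hf.1.norm.aemeasurable.pow_const q).aestronglyMeasurable ?_
  filter_upwards [hK] with x hx
  rw [Real.norm_of_nonneg (by positivity)]
  calc ‖f x‖ ^ q = ‖f x‖ ^ (q - p) * ‖f x‖ ^ p := by
        rw [← Real.rpow_add' (norm_nonneg _) (by linarith), sub_add_cancel]
    _ ≤ K ^ (q - p) * ‖f x‖ ^ p := by gcongr

/-- The partial gradient is the total derivative restricted to the second factor. Joint continuity
makes the flux `M_ξ(u, Du)` measurable. -/
theorem continuous_gradient_snd {E : Type*} [NormedAddCommGroup E] [InnerProductSpace ℝ E]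
    [CompleteSpace E] {M : ℝ → E → ℝ} (hM : ContDiff ℝ 1 fun z : ℝ × E => M z.1 z.2) :
    Continuous fun z : ℝ × E => ∇ (fun ξ => M z.1 ξ) z.2 := by
  have h : ∀ z : ℝ × E, fderiv ℝ (fun ξ => M z.1 ξ) z.2
      = (fderiv ℝ (fun z : ℝ × E => M z.1 z.2) z).comp (ContinuousLinearMap.inr ℝ ℝ E) :=
    fun z => by
      have hd : HasFDerivAt (fun z : ℝ × E => M z.1 z.2) _ (z.1, z.2) :=
        (hM.differentiable one_ne_zero z).hasFDerivAt
      exact (hd.comp z.2 (hasFDerivAt_prodMk_right z.1 z.2)).fderiv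
  refine (InnerProductSpace.toDual ℝ E).symm.continuous.comp ?_
  simp only [h]
  exact (hM.continuous_fderiv one_ne_zero).clm_comp continuous_const

theorem IsWeakSolution.exists_isEnergySolution {N : ℕ} {p m σ : ℝ} (hm1 : 1 < m) (hmp : m < p)
    {Ω : Set (Eucl N)} (hΩ : IsOpen Ω) {V : Eucl N → ℝ} (hV : ∀ x ∈ Ω, 0 ≤ V x)
    {L : Eucl N → ℝ} {M : ℝ → Eucl N → ℝ} {G : ℝ → ℝ} {ν C : ℝ} (hν : 0 ≤ ν)
    (hL : ContDiff ℝ 1 L) (hM : ContDiff ℝ 1 (fun z : ℝ × Eucl N => M z.1 z.2))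
    (hLconv : ConvexOn ℝ Set.univ L) (hMconv : ∀ s, ConvexOn ℝ Set.univ (M s))
    (hL₀ : ∀ ξ, ν * ‖ξ‖ ^ p ≤ |L ξ| ∧ |L ξ| ≤ C * ‖ξ‖ ^ p)
    (hLξ : ∀ ξ, ‖∇ L ξ‖ ≤ C * ‖ξ‖ ^ (p - 1))
    (hM₀ : ∀ s ξ, ν * ‖ξ‖ ^ m ≤ M s ξ ∧ M s ξ ≤ C * ‖ξ‖ ^ m)
    (hMξ : ∀ s ξ, ‖∇ (fun η => M s η) ξ‖ ≤ C * ‖ξ‖ ^ (m - 1))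
    (hG' : ∀ s, |deriv G s| ≤ C * |s| ^ (σ - 1))
    (hsign : ∀ s ξ, 0 ≤ deriv (fun t => M t ξ) s * s)
    {u : Eucl N → ℝ} (hu : IsWeakSolution Ω p m L M G V u) :
    ∃ Du, IsEnergySolution Ω p m σ ν C u Du (fun x => ∇ L (Du x))
      (fun x => ∇ (fun ξ => M (u x) ξ) (Du x)) (fun x => deriv G (u x)) := by
  obtain ⟨Du, hmem, heq⟩ := hu
  have hMabs : ∀ s ξ, |M s ξ| = M s ξ := fun s ξ =>
    abs_of_nonneg ((by positivity : 0 ≤ ν * ‖ξ‖ ^ m).trans (hM₀ s ξ).1)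
  have hMd : ∀ s, Differentiable ℝ (M s) := fun s =>
    (hM.comp (contDiff_const.prodMk contDiff_id)).differentiable one_ne_zero
  refine ⟨Du, hmem, hL.continuous_gradient.comp_aestronglyMeasurable hmem.grad_memLp.1,
    (continuous_gradient_snd hM).comp_aestronglyMeasurable
      (hmem.memLp.1.prodMk hmem.grad_memLp.1),
    fun x => hLconv.mul_rpow_le_inner_gradient (hL.differentiable one_ne_zero) (hm1.trans hmp)
      (fun ξ => (hL₀ ξ).1) (fun ξ => (hL₀ ξ).2) hLξ _,
    fun x => (hMconv (u x)).mul_rpow_le_inner_gradient (hMd _) hm1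
      (fun ξ => by rw [hMabs]; exact (hM₀ _ ξ).1) (fun ξ => by rw [hMabs]; exact (hM₀ _ ξ).2)
      (hMξ _) _,
    fun x => hLξ _, fun x => hMξ _ _, fun x => hG' _, fun v Dv hv huv hv0 => ?_⟩
  -- For `u ≠ 0`, divide `(b u)(u v) = (b v) u²` by `u²`. At `u = 0` the sign condition says nothing
  -- about `b`, which is why `v` must vanish there.
  have hnonneg : ∀ {b : ℝ} (x), 0 ≤ b * u x → 0 ≤ b * v x := fun {b} x hb => by
    rcases eq_or_ne (u x) 0 with hx | hx
    · rw [hv0 x hx, mul_zero]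
    · have h1 : 0 < u x ^ 2 := by positivity
      have h2 := mul_nonneg hb (huv x)
      exact nonneg_of_mul_nonneg_left (by linarith : 0 ≤ (b * v x) * u x ^ 2) h1
  have h1 : 0 ≤ ∫ x in Ω, deriv (fun s => M s (Du x)) (u x) * v x :=
    integral_nonneg fun x => hnonneg x (hsign _ _)
  have h2 : 0 ≤ ∫ x in Ω, V x * (|u x| ^ (p - 2) * u x) * v x :=
    setIntegral_nonneg hΩ.measurableSet fun x hx => hnonneg x (by
      have h3 := hV x hx
      have h4 : 0 ≤ V x * (|u x| ^ (p - 2) * u x ^ 2) := by positivity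
      linarith)
  have := (heq v Dv hv).2
  linarith

theorem proposition2p4 {N : ℕ} {p m σ : ℝ}
    -- exponents: `N > p > m > 1` and the range condition
    (hm1 : 1 < m) (hmp : m < p) (hpN : p < N)
    (hrange₁ : p - 1 ≤ m) (hrange₂ : m < p - 1 + p / N)
    (hσ₁ : p < σ) (hσ₂ : σ < N * p / (N - p))
    -- the exterior domain
    {Ω : Set (Eucl N)} (hΩ : IsOpen Ω) (hΩc : Bornology.IsBounded Ωᶜ)
    -- the potential
    {V : Eucl N → ℝ} {V₀ V_inf : ℝ} (hV : ContinuousOn V Ω)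
    (hVlim : Tendsto V (Bornology.cobounded (Eucl N) ⊓ 𝓟 Ω) (𝓝 V_inf))
    (hV₀ : 0 < V₀) (hVinf : ∀ x ∈ Ω, V₀ ≤ V x)
    -- the integrands
    {L : Eucl N → ℝ} {M : ℝ → Eucl N → ℝ} {G : ℝ → ℝ} {ν C : ℝ} (hν : 0 < ν)
    (hL : ContDiff ℝ 1 L) (hM : ContDiff ℝ 1 (fun z : ℝ × Eucl N => M z.1 z.2))
    (hG : ContDiff ℝ 1 G)
    (hLconv : StrictConvexOn ℝ Set.univ L)
    (hMconv : ∀ s, StrictConvexOn ℝ Set.univ (M s))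
    (hL₀ : ∀ ξ, ν * ‖ξ‖ ^ p ≤ |L ξ| ∧ |L ξ| ≤ C * ‖ξ‖ ^ p)
    (hLξ : ∀ ξ, ‖∇ L ξ‖ ≤ C * ‖ξ‖ ^ (p - 1))
    (hM₀ : ∀ s ξ, ν * ‖ξ‖ ^ m ≤ M s ξ ∧ M s ξ ≤ C * ‖ξ‖ ^ m)
    (hMs : ∀ s ξ, |deriv (fun t => M t ξ) s| ≤ C * ‖ξ‖ ^ m)
    (hMξ : ∀ s ξ, ‖∇ (fun η => M s η) ξ‖ ≤ C * ‖ξ‖ ^ (m - 1))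
    (hG' : ∀ s, |deriv G s| ≤ C * |s| ^ (σ - 1))
    -- the sign condition
    (hsign : ∀ s ξ, 0 ≤ deriv (fun t => M t ξ) s * s)
    -- the solution
    {u : Eucl N → ℝ} (hu : IsWeakSolution Ω p m L M G V u) :
    (∀ q : ℝ, p ≤ q → MemLp u (ENNReal.ofReal q) (volume.restrict Ω)) ∧
      MemLp u ∞ (volume.restrict Ω) ∧
      ∀ ε : ℝ, 0 < ε → ∃ R : ℝ, ∀ᵐ x ∂(volume.restrict Ω), R ≤ ‖x‖ → |u x| ≤ ε := by
  have hC : 0 ≤ C := by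
    have : Nonempty (Fin N) := Fin.pos_iff_nonempty.1 (by
      have : (0 : ℝ) < N := by linarith
      exact_mod_cast this)
    obtain ⟨ξ, hξ⟩ := exists_ne (0 : Eucl N)
    have hξ' : 0 < ‖ξ‖ ^ m := Real.rpow_pos_of_pos (norm_pos_iff.2 hξ) m
    exact hν.le.trans (le_of_mul_le_mul_right ((hM₀ 0 ξ).1.trans (hM₀ 0 ξ).2) hξ')
  obtain ⟨Du, h⟩ := hu.exists_isEnergySolution hm1 hmp hΩ
    (fun x hx => hV₀.le.trans (hVinf x hx)) hν.le hL hM hLconv.convexOn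
    (fun s => (hMconv s).convexOn) hL₀ hLξ hM₀ hMξ hG' hsign
  have htop := h.memLp_top hm1 hmp hpN hσ₁ rfl hσ₂.le hν hC
  exact ⟨fun q hq => h.mem.memLp.of_memLp_top (by linarith) hq htop, htop,
    fun ε hε => h.exists_ae_abs_le_of_le_norm hm1 hmp hpN hσ₁ rfl hσ₂.le hν hC hε⟩
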